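/- Consider linear switched systems $\Sigma=(n,Q,\{(A_q,B_q,C_q)\mid q\in Q\})$ with $Q=\{1,\dots,D\}$, $D\ge 1$, $A_q\in\mathbb R^{n\times n}$, $B_q\in\mathbb R^{n\times m}$, $C_q\in\mathbb R^{p\times n}$ ($D,m,p$ fixed, $n=\dim\Sigma$), either in continuous time, $\dot x(t)=A_{q(t)}x(t)+B_{q(t)}u(t)$ for a.e. $t\ge 0$, with $u\in L_2([0,\infty),\mathbb R^m)$, $q:[0,\infty)\to Q$ piecewise continuous and $x$ absolutely continuous on compact intervals, or in discrete time, $x(t+1)=A_{q(t)}x(t)+B_{q(t)}u(t)$, $t\in\mathbb N$, with $u\in l_2(\mathbb R^m)$ and $q:\mathbb N\to Q$ arbitrary; in both cases $x(0)=0$ and the output is $y(t)=C_{q(t)}x(t)$. Two systems are equivalent if they have the same input-output map $(u,q)\mapsto y$; a system is minimal if no equivalent system has a smaller dimension. An isomorphism $\mathcal S:\Sigma_1\to\Sigma_2$ between systems of dimension $n$ is a nonsingular $\mathcal S\in\mathbb R^{n\times n}$ such that $A^{(2)}_q\mathcal S=\mathcal S A^{(1)}_q$, $B^{(2)}_q=\mathcal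 S B^{(1)}_q$, $C^{(2)}_q\mathcal S=C^{(1)}_q$ for all $q\in Q$. For $\gamma>0$ define the following sets of symmetric positive definite $n\times n$ matrices $P$: * $\mathbf S(\Sigma)$: for all $q\in Q$, $A_q^TP+PA_q<0$ (continuous time), resp. $A_q^TPA_q-P<0$ (discrete time); * $\mathbf O(\Sigma)$: for all $q\in Q$, $A_q^TP+PA_q+C_q^TC_q\le 0$, resp. $A_q^TPA_q+C_q^TC_q-P\le 0$; * $\mathbf C(\Sigma)$: for all $q\in Q$, $A_qP+PA_q^T+B_qB_q^T\le 0$, resp. $A_qPA_q^T+B_qB_q^T-P\le 0$; * $\mathbf G_\gamma(\Sigma)$: for all $q\in Q$, $\begin{bmatrix}A_q^TP+PA_q+C_q^TC_q & PB_q\\ B_q^TP & -\gamma^2 I\end{bmatrix}<0$, resp. $\begin{bmatrix}A_q^TPA_q+C_q^TC_q-P & A_q^TPB_q\\ B_q^TPA_q & B_q^TPB_q-\gamma^2 I\end{bmatrix}<0$. For $\mathcal P\in\mathbf C(\Sigma)$ and $\mathscr Q\in\mathbf O(\Sigma)$, the singular values of $(\mathcal P,\mathscr Q)$ are the eigenvalues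 of $\mathcal P\mathscr Q$, counted with multiplicity. **Theorem.** In continuous time as well as in discrete time, let $\mathbf K$ be any of the symbols $\mathbf S,\mathbf O,\mathbf C,\mathbf G_\gamma$ ($\gamma>0$). 1. If $\mathbf K(\Sigma)\ne\emptyset$, then $\mathbf K(\Sigma_m)\ne\emptyset$ for every minimal system $\Sigma_m$ equivalent to $\Sigma$. 2. Let $\mathcal P\in\mathbf C(\Sigma)$, $\mathscr Q\in\mathbf O(\Sigma)$, $n=\dim\Sigma$, and let $\Sigma_m$ be a minimal system equivalent to $\Sigma$, $k=\dim\Sigma_m$ (so $k\le n$). Then there exist $\mathcal P_m\in\mathbf C(\Sigma_m)$ and $\mathscr Q_m\in\mathbf O(\Sigma_m)$ such that, if $\sigma_1\ge\dots\ge\sigma_n$ are the singular values of $(\mathcal P,\mathscr Q)$ and $\lambda_1\ge\dots\ge\lambda_k$ those of $(\mathcal P_m,\mathscr Q_m)$, then $\sigma_{n-k+i}\le\lambda_i\le\sigma_i$ for $i=1,\dots,k$. 3. Let $\Sigma_1,\Sigma_2$ be systems of dimension $n$ and $\mathcal S:\Sigma_1\to\Sigma_2$ an isomorphism. Put $M=\mathcal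 S^{-1}$ if $\mathbf K\in\{\mathbf S,\mathbf O,\mathbf G_\gamma\}$ and $M=\mathcal S^T$ if $\mathbf K=\mathbf C$. Then for every $P\in\mathbb R^{n\times n}$, $$P\in\mathbf K(\Sigma_1)\iff M^TPM\in\mathbf K(\Sigma_2).\qquad(*)$$ In particular, any two minimal and equivalent systems $\Sigma_1,\Sigma_2$ have the same dimension $n$, and there is a nonsingular matrix $M\in\mathbb R^{n\times n}$ such that $(*)$ holds for every $P\in\mathbb R^{n\times n}$. -/

import Mathlib

open MeasureTheory Filter Topology Matrix

/-- The two time axes: `T = [0, ∞)` and `T = ℕ`. -/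
inductive TimeKind where
  | continuous
  | discrete

/-- A linear switched system with discrete modes `Q = Fin D`, state space `ℝⁿ`, inputs in `ℝᵐ` and
outputs in `ℝᵖ`. The number `n` is the dimension of the system. -/
structure LSS (D n m p : ℕ) where
  A : Fin D → Matrix (Fin n) (Fin n) ℝ
  B : Fin D → Matrix (Fin n) (Fin m) ℝ
  C : Fin D → Matrix (Fin p) (Fin n) ℝ

/-- `f` is piecewise continuous on `[0, ∞)`: every compact interval `[0, b]` contains only finitely
many points of discontinuity, and all one-sided limits exist. (At the points of continuity the
one-sided limits exist anyway.) Only the restriction of `f` to `[0, ∞)` matters. -/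
def PiecewiseContinuous {E : Type*} [TopologicalSpace E] (f : ℝ → E) : Prop :=
  (∀ b : ℝ, {t ∈ Set.Icc 0 b | ¬ ContinuousWithinAt f (Set.Ici 0) t}.Finite) ∧
  (∀ t : ℝ, 0 < t → ∃ l, Tendsto f (𝓝[<] t) (𝓝 l)) ∧
  (∀ t : ℝ, 0 ≤ t → ∃ l, Tendsto f (𝓝[>] t) (𝓝 l))

namespace LSS

variable {D n n₁ n₂ m p : ℕ}

/-- Continuous time: `(x, y)` is a solution of the system with initial state `x₀` for the input `u`
and the switching signal `q`. The state trajectory `x` is absolutely continuous on every compact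
interval `[0, b]` and satisfies the differential equation almost everywhere on `[0, ∞)`. Signals
are functions on `ℝ` of which only the restriction to `[0, ∞)` is constrained. For piecewise
continuous `q` the output `y` is automatically piecewise continuous on `[0, ∞)`. -/
def IsSolutionCont (sys : LSS D n m p) (x₀ : Fin n → ℝ) (u : ℝ → Fin m → ℝ) (q : ℝ → Fin D)
    (x : ℝ → Fin n → ℝ) (y : ℝ → Fin p → ℝ) : Prop :=
  (∀ b : ℝ, 0 ≤ b → AbsolutelyContinuousOnInterval x 0 b) ∧
  x 0 = x₀ ∧
  (∀ᵐ t ∂(volume.restrict (Set.Ici (0 : ℝ))),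
    HasDerivAt x (sys.A (q t) *ᵥ x t + sys.B (q t) *ᵥ u t) t) ∧
  ∀ t : ℝ, 0 ≤ t → y t = sys.C (q t) *ᵥ x t

/-- Discrete time: `(x, y)` is a solution of the system with initial state `x₀` for the input `u`
and the switching signal `q`. -/
def IsSolutionDisc (sys : LSS D n m p) (x₀ : Fin n → ℝ) (u : ℕ → Fin m → ℝ) (q : ℕ → Fin D)
    (x : ℕ → Fin n → ℝ) (y : ℕ → Fin p → ℝ) : Prop :=
  x 0 = x₀ ∧
  (∀ t : ℕ, x (t + 1) = sys.A (q t) *ᵥ x t + sys.B (q t) *ᵥ u t) ∧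
  ∀ t : ℕ, y t = sys.C (q t) *ᵥ x t

/-- Continuous time: the graph of the input-output map induced by the initial state `x₀`, i.e. the
set of all triples `(u, q, y)` with `u ∈ L₂`, `q` piecewise continuous and `y` the output of the
solution for `(u, q)` starting at `x₀`. The values of `u`, `q`, `y` at negative times are
arbitrary, so two such graphs agree iff the maps of signals on `[0, ∞)` agree. (Whether a function
to `Fin m → ℝ` is in `L₂` does not depend on the norm of this finite-dimensional space.) -/
def ioGraphCont (sys : LSS D n m p) (x₀ : Fin n → ℝ) :
    Set ((ℝ → Fin m → ℝ) × (ℝ → Fin D) × (ℝ → Fin p → ℝ)) :=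
  {w | MemLp w.1 2 (volume.restrict (Set.Ici (0 : ℝ))) ∧ PiecewiseContinuous w.2.1 ∧
    ∃ x, sys.IsSolutionCont x₀ w.1 w.2.1 x w.2.2}

/-- Discrete time: the graph of the input-output map induced by the initial state `x₀`, i.e. the
set of all triples `(u, q, y)` with `u ∈ l₂`, `q` any switching sequence and `y` the output of the
solution for `(u, q)` starting at `x₀`. -/
def ioGraphDisc (sys : LSS D n m p) (x₀ : Fin n → ℝ) :
    Set ((ℕ → Fin m → ℝ) × (ℕ → Fin D) × (ℕ → Fin p → ℝ)) :=
  {w | Memℓp w.1 2 ∧ ∃ x, sys.IsSolutionDisc x₀ w.1 w.2.1 x w.2.2}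

/-- Two systems (possibly of different dimensions) are equivalent if their input-output maps
induced by the zero initial state are equal. -/
def Equivalent (τ : TimeKind) (sys₁ : LSS D n₁ m p) (sys₂ : LSS D n₂ m p) : Prop :=
  match τ with
  | .continuous => sys₁.ioGraphCont 0 = sys₂.ioGraphCont 0
  | .discrete => sys₁.ioGraphDisc 0 = sys₂.ioGraphDisc 0

/-- A system is minimal if no realization of its input-output map has a smaller dimension. -/
def IsMinimal (τ : TimeKind) (sys : LSS D n m p) : Prop :=
  ∀ (n' : ℕ) (sys' : LSS D n' m p), sys'.Equivalent τ sys → n ≤ n'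

/-- The matrix `S` is an isomorphism from `sys₁` to `sys₂`. -/
def IsIsomorphism (S : Matrix (Fin n) (Fin n) ℝ) (sys₁ sys₂ : LSS D n m p) : Prop :=
  IsUnit S ∧ ∀ q : Fin D,
    sys₂.A q * S = S * sys₁.A q ∧ sys₂.B q = S * sys₁.B q ∧ sys₂.C q * S = sys₁.C q

/-- The matrix `S(q, Σ, P)` of the quadratic stability inequality. -/
def stabMatrix (τ : TimeKind) (sys : LSS D n m p) (q : Fin D) (P : Matrix (Fin n) (Fin n) ℝ) :
    Matrix (Fin n) (Fin n) ℝ :=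
  match τ with
  | .continuous => (sys.A q)ᵀ * P + P * sys.A q
  | .discrete => (sys.A q)ᵀ * P * sys.A q - P

/-- The matrix `O(q, Σ, P)` of the observability grammian inequality. -/
def obsMatrix (τ : TimeKind) (sys : LSS D n m p) (q : Fin D) (P : Matrix (Fin n) (Fin n) ℝ) :
    Matrix (Fin n) (Fin n) ℝ :=
  match τ with
  | .continuous => (sys.A q)ᵀ * P + P * sys.A q + (sys.C q)ᵀ * sys.C q
  | .discrete => (sys.A q)ᵀ * P * sys.A q + (sys.C q)ᵀ * sys.C q - P

/-- The matrix `C(q, Σ, P)` of the controllability grammian inequality. -/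
def contrMatrix (τ : TimeKind) (sys : LSS D n m p) (q : Fin D) (P : Matrix (Fin n) (Fin n) ℝ) :
    Matrix (Fin n) (Fin n) ℝ :=
  match τ with
  | .continuous => sys.A q * P + P * (sys.A q)ᵀ + sys.B q * (sys.B q)ᵀ
  | .discrete => sys.A q * P * (sys.A q)ᵀ + sys.B q * (sys.B q)ᵀ - P

/-- The matrix `G_γ(q, Σ, P)` of the `L₂`-gain inequality. -/
def gainMatrix (τ : TimeKind) (γ : ℝ) (sys : LSS D n m p) (q : Fin D)
    (P : Matrix (Fin n) (Fin n) ℝ) : Matrix (Fin n ⊕ Fin m) (Fin n ⊕ Fin m) ℝ :=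
  match τ with
  | .continuous =>
      Matrix.fromBlocks
        ((sys.A q)ᵀ * P + P * sys.A q + (sys.C q)ᵀ * sys.C q) (P * sys.B q)
        ((sys.B q)ᵀ * P) (-(γ ^ 2 • (1 : Matrix (Fin m) (Fin m) ℝ)))
  | .discrete =>
      Matrix.fromBlocks
        ((sys.A q)ᵀ * P * sys.A q + (sys.C q)ᵀ * sys.C q - P) ((sys.A q)ᵀ * P * sys.B q)
        ((sys.B q)ᵀ * P * sys.A q)
        ((sys.B q)ᵀ * P * sys.B q - γ ^ 2 • (1 : Matrix (Fin m) (Fin m) ℝ))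

end LSS

/-- The symbols `S`, `O`, `C` and `G_γ` for `γ > 0`. -/
inductive LMISymbol where
  | S
  | O
  | C
  | G (γ : ℝ) (hγ : 0 < γ)

/-- The set `K(Σ)` of positive definite solutions of the linear matrix inequalities named by `K`:
strict ones for `S` and `G_γ`, non-strict ones for `O` and `C`. -/
def LSS.solutionSet {D n m p : ℕ} (τ : TimeKind) (K : LMISymbol) (sys : LSS D n m p) :
    Set (Matrix (Fin n) (Fin n) ℝ) :=
  match K with
  | .S => {P | P.PosDef ∧ ∀ q, (-(sys.stabMatrix τ q P)).PosDef}
  | .O => {P | P.PosDef ∧ ∀ q, (-(sys.obsMatrix τ q P)).PosSemidef}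
  | .C => {P | P.PosDef ∧ ∀ q, (-(sys.contrMatrix τ q P)).PosSemidef}
  | .G γ _ => {P | P.PosDef ∧ ∀ q, (-(sys.gainMatrix τ γ q P)).PosDef}

/-- The congruence matrix `M` attached to an isomorphism `S`: `Sᵀ` for the controllability
grammians and `S⁻¹` in all other cases. -/
noncomputable def LMISymbol.congruenceMatrix {n : ℕ} (K : LMISymbol)
    (S : Matrix (Fin n) (Fin n) ℝ) : Matrix (Fin n) (Fin n) ℝ :=
  match K with
  | .C => Sᵀ
  | .S => S⁻¹
  | .O => S⁻¹
  | .G _ _ => S⁻¹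

/-- `σ` lists the singular values of the pair `(P, R)`, i.e. the eigenvalues of `P * R` counted
with multiplicity, in decreasing order. -/
def IsSingularValues {n : ℕ} (P R : Matrix (Fin n) (Fin n) ℝ) (σ : Fin n → ℝ) : Prop :=
  Antitone σ ∧ (P * R).charpoly = ∏ i, (Polynomial.X - Polynomial.C (σ i))

/-! The first claim is that a minimal system is a quotient of a subsystem of every equivalent
system. Run two equivalent systems from zero with the same signals. The span `N` of the jointly
reached pairs of states is invariant under every pair of `A`-matrices, contains the images of every
pair of `B`-matrices, and the outputs agree on it. If the second system is minimal, `N` projects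
onto its state space by reachability and injects into the first state space by observability
(`IsMinimal.exists_subquotient`). If both are minimal, both projections are bijective and compose to
an isomorphism.

The second claim is that solutions of the inequalities survive passage to subsystems and quotients.
A positive definite `P` gives an inner product, and the smaller system is a compression along a
`P`-orthogonal projection. In continuous time the matrix inequality is simply compressed. In
discrete time a further term of the right sign appears, because the projection is a contraction
(`compression_mem_solutionSet`). The symbol `C` follows from `O` by duality.

For singular values, a basis with `P = T * Tᵀ` and `Tᵀ * R * T` diagonal turns each of the two
passages into the compression of a diagonal matrix by an isometry. Cauchy interlacing then applies
twice, and interlacing is transitive.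

The continuous-time part needs existence and uniqueness for linear equations whose coefficients are
merely measurable and bounded in time; this comes from the Volterra series. -/

namespace LSS

variable {D n n₁ n₂ m p : ℕ}

/-! ### Morphisms, duality and transport of the matrix inequalities -/

/-- `T` intertwines the two systems: it maps solutions of `sys₁` to solutions of `sys₂` with the
same input and output. -/
def IsMorphism (T : Matrix (Fin n₂) (Fin n₁) ℝ) (sys₁ : LSS D n₁ m p) (sys₂ : LSS D n₂ m p) :
    Prop :=
  ∀ q : Fin D, sys₂.A q * T = T * sys₁.A q ∧ sys₂.B q = T * sys₁.B q ∧ sys₂.C q * T = sys₁.C q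

/-- The dual system. -/
def dual (sys : LSS D n m p) : LSS D n p m :=
  ⟨fun q => (sys.A q)ᵀ, fun q => (sys.C q)ᵀ, fun q => (sys.B q)ᵀ⟩

theorem IsMorphism.dual {T : Matrix (Fin n₂) (Fin n₁) ℝ} {sys₁ : LSS D n₁ m p}
    {sys₂ : LSS D n₂ m p} (h : IsMorphism T sys₁ sys₂) : IsMorphism Tᵀ sys₂.dual sys₁.dual := by
  intro q
  obtain ⟨hA, hB, hC⟩ := h q
  simp only [LSS.dual, ← transpose_mul, hA, hB, hC, and_self]

theorem solutionSet_C_eq_dual (τ : TimeKind) (sys : LSS D n m p) :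
    sys.solutionSet τ .C = sys.dual.solutionSet τ .O := by
  cases τ <;> simp [solutionSet, contrMatrix, obsMatrix, LSS.dual]

/-- The hypothesis `hZP` says that `Z * W` is the `P`-orthogonal projection onto the range of `Z`.
Subsystems and quotients are both of this shape, with different choices of `Z` and `W`. -/
theorem compression_mem_solutionSet {τ : TimeKind} {K : LMISymbol} (hK : K ≠ .C)
    {sys₁ : LSS D n₁ m p} {sys₂ : LSS D n₂ m p} {P : Matrix (Fin n₁) (Fin n₁) ℝ}
    (hP : P ∈ sys₁.solutionSet τ K)
    {Z : Matrix (Fin n₁) (Fin n₂) ℝ} {W : Matrix (Fin n₂) (Fin n₁) ℝ} (hWZ : W * Z = 1)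
    (hZP : Zᵀ * P = Zᵀ * P * Z * W)
    (hA : ∀ q, sys₂.A q = W * sys₁.A q * Z) (hB : ∀ q, sys₂.B q = W * sys₁.B q)
    (hC : ∀ q, sys₂.C q = sys₁.C q * Z) :
    Zᵀ * P * Z ∈ sys₂.solutionSet τ K := by
  have hPd : P.PosDef := by cases K <;> exact hP.1
  have hPt : Pᵀ = P := by simpa using hPd.isHermitian.eq
  have hinj : Function.Injective Z.mulVec := fun x y h => by
    simpa [mulVec_mulVec, hWZ] using congrArg W.mulVec h
  have hP'd : (Zᵀ * P * Z).PosDef := by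
    simpa using hPd.conjTranspose_mul_mul_same hinj
  have hPZ : P * Z = Wᵀ * (Zᵀ * P * Z) := by
    have := congrArg transpose hZP
    simpa [transpose_mul, hPt, Matrix.mul_assoc] using this
  -- This form measures the squared `P`-length of the component that the projection `Z * W` removes,
  -- so it is nonnegative.
  have hE : (P - Wᵀ * (Zᵀ * P * Z) * W).PosSemidef := by
    have h1 := hPd.posSemidef.conjTranspose_mul_mul_same (1 - Z * W)
    have h2 : (1 - Z * W)ᴴ * P * (1 - Z * W) = P - Wᵀ * (Zᵀ * P * Z) * W := by
      have e2 : P * (Z * W) = Wᵀ * (Zᵀ * P * Z) * W := by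
        rw [← Matrix.mul_assoc, hPZ]
      have e1 : (Z * W)ᵀ * P = Wᵀ * (Zᵀ * P * Z) * W := by
        rw [transpose_mul, Matrix.mul_assoc, Matrix.mul_assoc Wᵀ, ← hZP]
      have e3 : (Z * W)ᵀ * P * (Z * W) = Wᵀ * (Zᵀ * P * Z) * W := by
        rw [e1, Matrix.mul_assoc _ W, ← Matrix.mul_assoc W, hWZ, Matrix.one_mul]
      rw [conjTranspose_eq_transpose_of_trivial, transpose_sub, transpose_one, Matrix.sub_mul,
        Matrix.one_mul, Matrix.mul_sub, Matrix.mul_one, Matrix.sub_mul, e3, e1, e2]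
      abel
    rwa [h2] at h1
  generalize hP' : Zᵀ * P * Z = P' at *
  have hAP : ∀ q, (sys₂.A q)ᵀ * P' = Zᵀ * ((sys₁.A q)ᵀ * P) * Z := fun q => by
    simp only [hA, transpose_mul, Matrix.mul_assoc, hPZ]
  have hPA : ∀ q, P' * sys₂.A q = Zᵀ * (P * sys₁.A q) * Z := fun q => by
    rw [hA, ← Matrix.mul_assoc, ← Matrix.mul_assoc, ← hZP]
    simp only [Matrix.mul_assoc]
  have hPB : ∀ q, P' * sys₂.B q = Zᵀ * (P * sys₁.B q) := fun q => by
    rw [hB, ← Matrix.mul_assoc, ← hZP, Matrix.mul_assoc]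
  have hCC : ∀ q, (sys₂.C q)ᵀ * sys₂.C q = Zᵀ * ((sys₁.C q)ᵀ * sys₁.C q) * Z := fun q => by
    simp only [hC, transpose_mul, Matrix.mul_assoc]
  -- In discrete time the projection acts after `A`, which loses a positive semidefinite term. In
  -- continuous time the compressed inequality is an exact congruence.
  have hAPA : ∀ q, Zᵀ * ((sys₁.A q)ᵀ * P * sys₁.A q) * Z =
      (sys₂.A q)ᵀ * P' * sys₂.A q + (sys₁.A q * Z)ᵀ * (P - Wᵀ * P' * W) * (sys₁.A q * Z) :=
    fun q => by
      simp only [hA, transpose_mul, Matrix.mul_assoc, Matrix.mul_sub, Matrix.sub_mul]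
      abel
  have hEA := fun q => hE.conjTranspose_mul_mul_same (sys₁.A q * Z)
  have hinj' : Function.Injective (fromBlocks Z 0 0 (1 : Matrix (Fin m) (Fin m) ℝ)).mulVec := by
    have : fromBlocks W 0 0 (1 : Matrix (Fin m) (Fin m) ℝ) *
        fromBlocks Z 0 0 (1 : Matrix (Fin m) (Fin m) ℝ) = 1 := by
      simp [fromBlocks_multiply, hWZ]
    intro x y h
    simpa [mulVec_mulVec, this] using
      congrArg (fromBlocks W 0 0 (1 : Matrix (Fin m) (Fin m) ℝ)).mulVec h
  cases K with
  | C => exact absurd rfl hK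
  | S =>
    refine ⟨hP'd, fun q => ?_⟩
    have h := (hP.2 q).conjTranspose_mul_mul_same hinj
    cases τ with
    | continuous =>
      convert h using 1
      simp only [stabMatrix, hAP, hPA, conjTranspose_eq_transpose_of_trivial]
      simp only [Matrix.mul_neg, Matrix.neg_mul, Matrix.mul_add, Matrix.add_mul]
    | discrete =>
      convert h.add_posSemidef (hEA q) using 1
      simp only [stabMatrix, conjTranspose_eq_transpose_of_trivial]
      rw [Matrix.mul_neg, Matrix.neg_mul, Matrix.mul_sub, Matrix.sub_mul, hAPA, hP']
      abel
  | O =>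
    refine ⟨hP'd, fun q => ?_⟩
    have h := (hP.2 q).conjTranspose_mul_mul_same Z
    cases τ with
    | continuous =>
      convert h using 1
      simp only [obsMatrix, hAP, hPA, hCC, conjTranspose_eq_transpose_of_trivial]
      simp only [Matrix.mul_neg, Matrix.neg_mul, Matrix.mul_add, Matrix.add_mul]
    | discrete =>
      convert h.add (hEA q) using 1
      simp only [obsMatrix, hCC, conjTranspose_eq_transpose_of_trivial]
      rw [Matrix.mul_neg, Matrix.neg_mul, Matrix.mul_sub, Matrix.sub_mul, Matrix.mul_add,
        Matrix.add_mul, hAPA, hP']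
      abel
  | G γ hγ =>
    refine ⟨hP'd, fun q => ?_⟩
    have h := (hP.2 q).conjTranspose_mul_mul_same hinj'
    cases τ with
    | continuous =>
      convert h using 1
      have hBP : (sys₂.B q)ᵀ * P' = (sys₁.B q)ᵀ * P * Z := by
        rw [Matrix.mul_assoc, hPZ, hB, transpose_mul, Matrix.mul_assoc]
      rw [Matrix.mul_neg, Matrix.neg_mul]
      simp only [gainMatrix, hAP, hPA, hCC, hPB, hBP, conjTranspose_eq_transpose_of_trivial,
        fromBlocks_transpose, fromBlocks_multiply, transpose_zero,
        transpose_one, Matrix.mul_zero, Matrix.zero_mul, add_zero, zero_add, Matrix.one_mul,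
        Matrix.mul_one]
      simp only [Matrix.mul_add, Matrix.add_mul]
    | discrete =>
      -- The projection acts on the whole next state `A x + B u`, so the lost term involves the
      -- block row with entries `A Z` and `B`.
      convert h.add_posSemidef (hE.conjTranspose_mul_mul_same
        (fromCols (sys₁.A q * Z) (sys₁.B q))) using 1
      have e : (fromCols (sys₁.A q * Z) (sys₁.B q))ᴴ * (P - Wᵀ * P' * W) *
          fromCols (sys₁.A q * Z) (sys₁.B q) = fromBlocks
          ((sys₁.A q * Z)ᵀ * (P - Wᵀ * P' * W) * (sys₁.A q * Z))
          ((sys₁.A q * Z)ᵀ * (P - Wᵀ * P' * W) * sys₁.B q)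
          ((sys₁.B q)ᵀ * (P - Wᵀ * P' * W) * (sys₁.A q * Z))
          ((sys₁.B q)ᵀ * (P - Wᵀ * P' * W) * sys₁.B q) := by
        rw [conjTranspose_eq_transpose_of_trivial, transpose_fromCols, fromRows_mul,
          fromRows_mul_fromCols]
      rw [e, Matrix.mul_neg, Matrix.neg_mul]
      simp only [gainMatrix, conjTranspose_eq_transpose_of_trivial,
        fromBlocks_transpose, fromBlocks_multiply, transpose_zero,
        transpose_one, Matrix.mul_zero, Matrix.zero_mul, add_zero, zero_add, Matrix.one_mul,
        Matrix.mul_one, fromBlocks_neg, fromBlocks_add]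
      congr 1
      · rw [hCC, Matrix.mul_sub, Matrix.sub_mul, Matrix.mul_add, Matrix.add_mul, hAPA, hP']
        abel
      all_goals
        simp only [hA, hB, transpose_mul, Matrix.mul_sub, Matrix.sub_mul, Matrix.mul_assoc]
        abel

/-- Restriction along a split injective morphism. -/
theorem IsMorphism.restrict_mem {τ : TimeKind} {K : LMISymbol} (hK : K ≠ .C)
    {sys₁ : LSS D n₁ m p} {sys₂ : LSS D n₂ m p} {P : Matrix (Fin n₁) (Fin n₁) ℝ}
    (hP : P ∈ sys₁.solutionSet τ K) {V : Matrix (Fin n₁) (Fin n₂) ℝ}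
    (hV : IsMorphism V sys₂ sys₁) {L : Matrix (Fin n₂) (Fin n₁) ℝ} (hL : L * V = 1) :
    Vᵀ * P * V ∈ sys₂.solutionSet τ K := by
  have hPd : P.PosDef := by cases K <;> exact hP.1
  have hinj : Function.Injective V.mulVec := fun x y h => by
    simpa [mulVec_mulVec, hL] using congrArg L.mulVec h
  have hu : IsUnit (Vᵀ * P * V).det := by
    have : (Vᵀ * P * V).PosDef := by simpa using hPd.conjTranspose_mul_mul_same hinj
    exact (isUnit_iff_isUnit_det _).1 this.isUnit
  have hWV : (Vᵀ * P * V)⁻¹ * (Vᵀ * P) * V = 1 := by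
    rw [Matrix.mul_assoc, nonsing_inv_mul _ hu]
  -- This `W` is the left inverse of `V` along the `P`-orthogonal complement of its range.
  refine compression_mem_solutionSet hK hP (W := (Vᵀ * P * V)⁻¹ * (Vᵀ * P)) hWV ?_ ?_ ?_ ?_
  · rw [← Matrix.mul_assoc, mul_nonsing_inv _ hu, Matrix.one_mul]
  · intro q
    rw [Matrix.mul_assoc _ (sys₁.A q), (hV q).1, ← Matrix.mul_assoc, hWV, Matrix.one_mul]
  · intro q
    rw [(hV q).2.1, ← Matrix.mul_assoc, hWV, Matrix.one_mul]
  · exact fun q => (hV q).2.2.symm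

/-- Passage to a quotient along a split surjective morphism. -/
theorem IsMorphism.quotient_mem {τ : TimeKind} {K : LMISymbol} (hK : K ≠ .C)
    {sys₁ : LSS D n₁ m p} {sys₂ : LSS D n₂ m p} {P : Matrix (Fin n₁) (Fin n₁) ℝ}
    (hP : P ∈ sys₁.solutionSet τ K) {W : Matrix (Fin n₂) (Fin n₁) ℝ}
    (hW : IsMorphism W sys₁ sys₂) {L : Matrix (Fin n₁) (Fin n₂) ℝ} (hL : W * L = 1) :
    (W * P⁻¹ * Wᵀ)⁻¹ ∈ sys₂.solutionSet τ K := by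
  have hPd : P.PosDef := by cases K <;> exact hP.1
  have hPt : Pᵀ = P := by simpa using hPd.isHermitian.eq
  have hPu : IsUnit P.det := (isUnit_iff_isUnit_det _).1 hPd.isUnit
  have hinj : Function.Injective W.vecMul := fun x y h => by
    simpa [vecMul_vecMul, hL] using congrArg L.vecMul h
  have hYd : (W * P⁻¹ * Wᵀ).PosDef := by simpa using hPd.inv.mul_mul_conjTranspose_same hinj
  have hYt : (W * P⁻¹ * Wᵀ)ᵀ = W * P⁻¹ * Wᵀ := by simpa using hYd.isHermitian.eq
  have hu : IsUnit (W * P⁻¹ * Wᵀ).det := (isUnit_iff_isUnit_det _).1 hYd.isUnit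
  -- This `Z` lifts the quotient to the `P`-orthogonal complement of the kernel of `W`.
  set Z : Matrix (Fin n₁) (Fin n₂) ℝ := P⁻¹ * Wᵀ * (W * P⁻¹ * Wᵀ)⁻¹ with hZ
  have hWZ : W * Z = 1 := by
    rw [hZ, ← Matrix.mul_assoc, ← Matrix.mul_assoc, mul_nonsing_inv _ hu]
  have hZt : Zᵀ * P = (W * P⁻¹ * Wᵀ)⁻¹ * W := by
    rw [hZ, transpose_mul, transpose_nonsing_inv, hYt, transpose_mul, transpose_transpose,
      transpose_nonsing_inv, hPt, ← Matrix.mul_assoc, Matrix.mul_assoc _ P⁻¹ P,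
      nonsing_inv_mul _ hPu, Matrix.mul_one]
  have hZPZ : Zᵀ * P * Z = (W * P⁻¹ * Wᵀ)⁻¹ := by
    rw [hZt, Matrix.mul_assoc, hWZ, Matrix.mul_one]
  rw [← hZPZ]
  refine compression_mem_solutionSet hK hP hWZ ?_ ?_ ?_ ?_
  · rw [hZPZ, hZt]
  · intro q
    rw [← (hW q).1, Matrix.mul_assoc, hWZ, Matrix.mul_one]
  · exact fun q => (hW q).2.1
  · intro q
    rw [← (hW q).2.2, Matrix.mul_assoc, hWZ, Matrix.mul_one]

/-- Transposition turns a subsystem into a quotient of the dual system, and `C` into `O`. -/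
theorem IsMorphism.restrict_mem_C {τ : TimeKind}
    {sys₁ : LSS D n₁ m p} {sys₂ : LSS D n₂ m p} {P : Matrix (Fin n₁) (Fin n₁) ℝ}
    (hP : P ∈ sys₁.solutionSet τ .C) {V : Matrix (Fin n₁) (Fin n₂) ℝ}
    (hV : IsMorphism V sys₂ sys₁) {L : Matrix (Fin n₂) (Fin n₁) ℝ} (hL : L * V = 1) :
    (Vᵀ * P⁻¹ * V)⁻¹ ∈ sys₂.solutionSet τ .C := by
  rw [solutionSet_C_eq_dual] at *
  have := hV.dual.quotient_mem (by simp) hP (L := Lᵀ) (by rw [← transpose_mul, hL, transpose_one])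
  rwa [transpose_transpose] at this

theorem IsMorphism.quotient_mem_C {τ : TimeKind}
    {sys₁ : LSS D n₁ m p} {sys₂ : LSS D n₂ m p} {P : Matrix (Fin n₁) (Fin n₁) ℝ}
    (hP : P ∈ sys₁.solutionSet τ .C) {W : Matrix (Fin n₂) (Fin n₁) ℝ}
    (hW : IsMorphism W sys₁ sys₂) {L : Matrix (Fin n₁) (Fin n₂) ℝ} (hL : W * L = 1) :
    W * P * Wᵀ ∈ sys₂.solutionSet τ .C := by
  rw [solutionSet_C_eq_dual] at *
  have := hW.dual.restrict_mem (by simp) hP (L := Lᵀ) (by rw [← transpose_mul, hL, transpose_one])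
  rwa [transpose_transpose] at this

/-! ### Isomorphisms and congruence -/

theorem IsIsomorphism.isMorphism {S : Matrix (Fin n) (Fin n) ℝ} {sys₁ sys₂ : LSS D n m p}
    (h : IsIsomorphism S sys₁ sys₂) : IsMorphism S sys₁ sys₂ := h.2

theorem IsIsomorphism.inv {S : Matrix (Fin n) (Fin n) ℝ} {sys₁ sys₂ : LSS D n m p}
    (h : IsIsomorphism S sys₁ sys₂) : IsIsomorphism S⁻¹ sys₂ sys₁ := by
  have hu := (isUnit_iff_isUnit_det _).1 h.1
  refine ⟨isUnit_nonsing_inv_iff.2 h.1, fun q => ⟨?_, ?_, ?_⟩⟩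
  · calc sys₁.A q * S⁻¹ = S⁻¹ * (S * sys₁.A q) * S⁻¹ := by
          rw [← Matrix.mul_assoc, nonsing_inv_mul _ hu, Matrix.one_mul]
      _ = S⁻¹ * sys₂.A q := by
          rw [← (h.2 q).1, Matrix.mul_assoc, Matrix.mul_assoc, mul_nonsing_inv _ hu,
            Matrix.mul_one]
  · rw [(h.2 q).2.1, ← Matrix.mul_assoc, nonsing_inv_mul _ hu, Matrix.one_mul]
  · rw [← (h.2 q).2.2, Matrix.mul_assoc, mul_nonsing_inv _ hu, Matrix.mul_one]

theorem IsIsomorphism.congr_mem {τ : TimeKind} {K : LMISymbol}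
    {S : Matrix (Fin n) (Fin n) ℝ} {sys₁ sys₂ : LSS D n m p}
    (h : IsIsomorphism S sys₁ sys₂) {P : Matrix (Fin n) (Fin n) ℝ}
    (hP : P ∈ sys₁.solutionSet τ K) :
    (K.congruenceMatrix S)ᵀ * P * K.congruenceMatrix S ∈ sys₂.solutionSet τ K := by
  have hu := (isUnit_iff_isUnit_det _).1 h.1
  cases K with
  | C =>
    have := h.isMorphism.quotient_mem_C hP (mul_nonsing_inv _ hu)
    simpa [LMISymbol.congruenceMatrix] using this
  | _ => exact h.inv.isMorphism.restrict_mem (by simp) hP (mul_nonsing_inv _ hu)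

theorem congruenceMatrix_mul_inv (K : LMISymbol) {S : Matrix (Fin n) (Fin n) ℝ} (h : IsUnit S) :
    K.congruenceMatrix S * K.congruenceMatrix S⁻¹ = 1 := by
  have hu := (isUnit_iff_isUnit_det _).1 h
  cases K with
  | C => simp only [LMISymbol.congruenceMatrix]
         rw [← transpose_mul, nonsing_inv_mul _ hu, transpose_one]
  | _ => simp only [LMISymbol.congruenceMatrix]
         rw [nonsing_inv_nonsing_inv _ hu, nonsing_inv_mul _ hu]

theorem IsIsomorphism.mem_solutionSet_iff {τ : TimeKind} {K : LMISymbol}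
    {S : Matrix (Fin n) (Fin n) ℝ} {sys₁ sys₂ : LSS D n m p}
    (h : IsIsomorphism S sys₁ sys₂) (P : Matrix (Fin n) (Fin n) ℝ) :
    P ∈ sys₁.solutionSet τ K ↔
      (K.congruenceMatrix S)ᵀ * P * K.congruenceMatrix S ∈ sys₂.solutionSet τ K := by
  refine ⟨h.congr_mem, fun hP => ?_⟩
  have h1 := congruenceMatrix_mul_inv K h.1
  have h2 : (K.congruenceMatrix S⁻¹)ᵀ * (K.congruenceMatrix S)ᵀ = 1 := by
    rw [← transpose_mul, h1, transpose_one]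
  have := h.inv.congr_mem hP
  rwa [Matrix.mul_assoc, Matrix.mul_assoc, h1, Matrix.mul_one, ← Matrix.mul_assoc, h2,
    Matrix.one_mul] at this

end LSS

/-! ### Simultaneous diagonalization and interlacing of singular values -/

/-- Factor `P = S * Sᵀ` and take `T = S * U`, where the orthogonal `U` diagonalizes `Sᵀ * R * S`.
Then `P * R` is conjugate by `T` to `diagonal σ`. -/
theorem exists_simultaneous_diagonalization {n : ℕ} {P R : Matrix (Fin n) (Fin n) ℝ}
    (hP : P.PosDef) (hR : R.IsHermitian) :
    ∃ (T : Matrix (Fin n) (Fin n) ℝ) (σ : Fin n → ℝ), IsUnit T.det ∧ Antitone σ ∧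
      T * Tᵀ = P ∧ Tᵀ * R * T = diagonal σ := by
  obtain ⟨S, hS⟩ : ∃ S : Matrix (Fin n) (Fin n) ℝ, P = S * Sᵀ := by
    open MatrixOrder in
    obtain ⟨y, hy⟩ := CStarAlgebra.nonneg_iff_eq_star_mul_self.mp hP.posSemidef.nonneg
    exact ⟨yᵀ, by simpa [star_eq_conjTranspose] using hy⟩
  have hH : (Sᵀ * R * S).IsHermitian := by
    simpa using isHermitian_conjTranspose_mul_mul S hR
  set U : Matrix (Fin n) (Fin n) ℝ := ↑hH.eigenvectorUnitary with hU
  have hUU : U * Uᵀ = 1 := by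
    simpa [star_eq_conjTranspose] using Unitary.coe_mul_star_self hH.eigenvectorUnitary
  have hUU' : Uᵀ * U = 1 := mul_eq_one_comm.1 hUU
  have hdiag : Uᵀ * (Sᵀ * R * S) * U = diagonal hH.eigenvalues := by
    have := hH.conjStarAlgAut_star_eigenvectorUnitary
    simpa [Unitary.conjStarAlgAut_star_apply, star_eq_conjTranspose, Function.comp_def] using this
  -- The permutation `e` undoes the indexing of `eigenvalues`, so that the eigenvalues appear in
  -- decreasing order.
  let e : Fin n ≃ Fin n :=
    (finCongr (Fintype.card_fin n)).symm.trans
      (Fintype.equivOfCardEq (Fintype.card_fin _))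
  have he : ∀ i, hH.eigenvalues (e i) = hH.eigenvalues₀ (Fin.cast (Fintype.card_fin n).symm i) := by
    intro i
    simp [IsHermitian.eigenvalues, e]
  suffices h : ∃ (T : Matrix (Fin n) (Fin n) ℝ) (σ : Fin n → ℝ), Antitone σ ∧
      T * Tᵀ = P ∧ Tᵀ * R * T = diagonal σ by
    obtain ⟨T, σ, hσ, hT, hR⟩ := h
    refine ⟨T, σ, ?_, hσ, hT, hR⟩
    have := (isUnit_iff_isUnit_det _).1 hP.isUnit
    rw [← hT, det_mul] at this
    exact isUnit_of_mul_isUnit_left this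
  refine ⟨S * U.submatrix id e, hH.eigenvalues ∘ e, ?_, ?_, ?_⟩
  · intro i j hij
    simp only [Function.comp, he]
    exact hH.eigenvalues₀_antitone hij
  · have : U.submatrix id e * (U.submatrix id e)ᵀ = 1 := by
      rw [transpose_submatrix, submatrix_mul_equiv, hUU]; simp
    rw [transpose_mul, Matrix.mul_assoc, ← Matrix.mul_assoc _ _ Sᵀ, this, Matrix.one_mul, hS]
  · have : (U.submatrix id e)ᵀ * (Sᵀ * R * S) * U.submatrix id e =
        (Uᵀ * (Sᵀ * R * S) * U).submatrix e e := by
      ext i j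
      simp [Matrix.mul_apply]
    rw [hdiag] at this
    simp only [transpose_mul, Matrix.mul_assoc] at this ⊢
    rw [this]
    simp

/-- The Courant–Fischer argument: some nonzero `z` is supported on the indices up to `i` while `Y *ᵥ
z` vanishes on the indices below `j`. The common Rayleigh quotient of `z` and `Y *ᵥ z` is then at
least `μ i` and at most `σ j`. -/
theorem le_of_isometry_diagonal {n k : ℕ} {σ : Fin n → ℝ} {μ : Fin k → ℝ} (hσ : Antitone σ)
    (hμ : Antitone μ) {Y : Matrix (Fin n) (Fin k) ℝ} (hY : Yᵀ * Y = 1)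
    (hD : Yᵀ * diagonal σ * Y = diagonal μ) (i : Fin k) (j : Fin n) (hij : (i : ℕ) = j) :
    μ i ≤ σ j := by
  -- The source has dimension `i + 1` and the target dimension `j = i`, so the kernel is nonzero.
  let f : (Finset.Iic i → ℝ) →ₗ[ℝ] (Finset.Iio j → ℝ) :=
    (LinearMap.funLeft ℝ ℝ (Subtype.val : Finset.Iio j → Fin n)) ∘ₗ Y.mulVecLin ∘ₗ
      (Function.ExtendByZero.linearMap ℝ (Subtype.val : Finset.Iic i → Fin k))
  have hf : LinearMap.ker f ≠ ⊥ := by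
    apply LinearMap.ker_ne_bot_of_finrank_lt
    rw [Module.finrank_fintype_fun_eq_card, Module.finrank_fintype_fun_eq_card, Fintype.card_coe,
      Fintype.card_coe, Fin.card_Iio, Fin.card_Iic, hij]
    exact Nat.lt_succ_self _
  obtain ⟨w, hw, hw0⟩ := (Submodule.ne_bot_iff _).1 hf
  set z : Fin k → ℝ := Function.extend (Subtype.val : Finset.Iic i → Fin k) w 0 with hz
  have hz0 : ∀ l, i < l → z l = 0 := by
    intro l hl
    rw [hz, Function.extend_apply' _ _ _ (by rintro ⟨a, rfl⟩; have := Finset.mem_Iic.1 a.2; omega)]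
    rfl
  have hYz : ∀ l, l < j → (Y *ᵥ z) l = 0 := by
    intro l hl
    exact congrFun (LinearMap.mem_ker.1 hw) ⟨l, by simpa using hl⟩
  have hzne : z ≠ 0 := by
    intro h
    apply hw0
    ext a
    have := congrFun h a
    rwa [hz, Subtype.val_injective.extend_apply] at this
  have hpos : 0 < z ⬝ᵥ z := by
    simpa using (dotProduct_star_self_pos_iff (v := z)).2 hzne
  have h1 : (Y *ᵥ z) ⬝ᵥ (Y *ᵥ z) = z ⬝ᵥ z := by
    rw [dotProduct_mulVec, ← mulVec_transpose, mulVec_mulVec, hY, one_mulVec]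
  have h2 : (Y *ᵥ z) ⬝ᵥ (diagonal σ *ᵥ (Y *ᵥ z)) = z ⬝ᵥ (diagonal μ *ᵥ z) := by
    rw [← hD, ← mulVec_mulVec, ← mulVec_mulVec, dotProduct_mulVec z, vecMul_transpose]
  have h3 : (Y *ᵥ z) ⬝ᵥ (diagonal σ *ᵥ (Y *ᵥ z)) ≤ σ j * ((Y *ᵥ z) ⬝ᵥ (Y *ᵥ z)) := by
    simp only [dotProduct, mulVec_diagonal, Finset.mul_sum]
    refine Finset.sum_le_sum fun l _ => ?_
    rcases lt_or_ge l j with hl | hl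
    · simp [hYz l hl]
    · nlinarith [hσ hl, mul_self_nonneg ((Y *ᵥ z) l)]
  have h4 : μ i * (z ⬝ᵥ z) ≤ z ⬝ᵥ (diagonal μ *ᵥ z) := by
    simp only [dotProduct, mulVec_diagonal, Finset.mul_sum]
    refine Finset.sum_le_sum fun l _ => ?_
    rcases lt_or_ge i l with hl | hl
    · simp [hz0 l hl]
    · nlinarith [hμ hl, mul_self_nonneg (z l)]
  rw [h2, h1] at h3
  exact le_of_mul_le_mul_right (h4.trans h3) hpos

/-- Cauchy interlacing for a compression of a diagonal matrix. -/
theorem interlacing_of_isometry_diagonal {n k : ℕ} {σ : Fin n → ℝ} {μ : Fin k → ℝ}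
    (hσ : Antitone σ) (hμ : Antitone μ) {Y : Matrix (Fin n) (Fin k) ℝ} (hY : Yᵀ * Y = 1)
    (hD : Yᵀ * diagonal σ * Y = diagonal μ) (i : Fin k) (j : Fin n) :
    ((i : ℕ) = j → μ i ≤ σ j) ∧ (n - k + i = j → k ≤ n → σ j ≤ μ i) := by
  refine ⟨le_of_isometry_diagonal hσ hμ hY hD i j, fun hij hkn => ?_⟩
  -- Negating both sequences and reversing their order turns the upper bound into the lower one.
  have h := le_of_isometry_diagonal (σ := fun l => -σ l.rev) (μ := fun l => -μ l.rev)
    (fun a b hab => neg_le_neg (hσ (Fin.rev_le_rev.2 hab)))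
    (fun a b hab => neg_le_neg (hμ (Fin.rev_le_rev.2 hab)))
    (Y := Y.submatrix Fin.revPerm Fin.revPerm) ?_ ?_ i.rev j.rev
    (by simp only [Fin.val_rev]; omega)
  · simpa using h
  · rw [transpose_submatrix, submatrix_mul_equiv, hY]; simp
  · have e : diagonal (fun l => -σ l.rev) = -(diagonal σ).submatrix Fin.revPerm Fin.revPerm := by
      rw [submatrix_diagonal_equiv, ← diagonal_neg]; rfl
    have e' : diagonal (fun l => -μ l.rev) = -(diagonal μ).submatrix Fin.revPerm Fin.revPerm := by
      rw [submatrix_diagonal_equiv, ← diagonal_neg]; rfl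
    rw [e, e', Matrix.mul_neg, Matrix.neg_mul, transpose_submatrix, submatrix_mul_equiv,
      submatrix_mul_equiv, hD]

theorem Matrix.le_of_transpose_mul_self_eq_one {n k : ℕ} {Y : Matrix (Fin n) (Fin k) ℝ}
    (hY : Yᵀ * Y = 1) : k ≤ n := by
  have h1 : (Yᵀ * Y).rank ≤ n := (rank_mul_le_right _ _).trans ((rank_le_card_height Y).trans (by simp))
  simpa [hY] using h1

theorem IsSingularValues.of_diagonalization {n : ℕ} {P R T : Matrix (Fin n) (Fin n) ℝ}
    {σ : Fin n → ℝ} (hT : IsUnit T.det) (hσ : Antitone σ) (hP : T * Tᵀ = P)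
    (hR : Tᵀ * R * T = diagonal σ) : IsSingularValues P R σ := by
  refine ⟨hσ, ?_⟩
  have : P * R = T * diagonal σ * T⁻¹ := by
    rw [← hP, ← hR]
    simp only [Matrix.mul_assoc, mul_nonsing_inv _ hT, Matrix.mul_one]
  rw [this, Matrix.mul_assoc, charpoly_mul_comm, Matrix.mul_assoc, nonsing_inv_mul _ hT,
    Matrix.mul_one, charpoly_diagonal]

/-- `μ` interlaces `σ`. -/
def Interlaces {n k : ℕ} (μ : Fin k → ℝ) (σ : Fin n → ℝ) : Prop :=
  ∃ hkn : k ≤ n, ∀ i : Fin k, σ ⟨n - k + i, by omega⟩ ≤ μ i ∧ μ i ≤ σ ⟨i, by omega⟩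

theorem Interlaces.trans {n l k : ℕ} {μ : Fin k → ℝ} {ν : Fin l → ℝ} {σ : Fin n → ℝ}
    (h₁ : Interlaces μ ν) (h₂ : Interlaces ν σ) : Interlaces μ σ := by
  obtain ⟨hkl, h₁⟩ := h₁
  obtain ⟨hln, h₂⟩ := h₂
  refine ⟨hkl.trans hln, fun i => ⟨?_, (h₁ i).2.trans (h₂ _).2⟩⟩
  refine (le_of_eq (congrArg σ (Fin.ext ?_))).trans ((h₂ _).1.trans (h₁ i).1)
  change n - k + i = n - l + (l - k + i)
  omega

/-- The characteristic polynomial fixes the multiset of roots, and a multiset has only one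
decreasing listing. -/
theorem IsSingularValues.eq {n : ℕ} {P R P' R' : Matrix (Fin n) (Fin n) ℝ} {σ σ' : Fin n → ℝ}
    (h : IsSingularValues P R σ) (h' : IsSingularValues P' R' σ')
    (hc : (P * R).charpoly = (P' * R').charpoly) : σ = σ' := by
  have key : ∀ f : Fin n → ℝ,
      (∏ i, (Polynomial.X - Polynomial.C (f i))).roots = (List.ofFn f : Multiset ℝ) := by
    intro f
    rw [Finset.prod_eq_multiset_prod,
      show (fun i => Polynomial.X - Polynomial.C (f i)) =
        (fun a => Polynomial.X - Polynomial.C a) ∘ f from rfl, ← Multiset.map_map,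
      Polynomial.roots_multiset_prod_X_sub_C, Fin.univ_val_map]
  have := congrArg Polynomial.roots (h.2.symm.trans (hc.trans h'.2))
  rw [key, key, Multiset.coe_eq_coe] at this
  exact List.ofFn_injective (this.eq_of_sortedGE h.1.sortedGE_ofFn h'.1.sortedGE_ofFn)

/-- With diagonalizing bases `T` before and `T'` after restriction, `Y = T⁻¹ * V * T'` is an
isometry that compresses `diagonal σ` to `diagonal μ`. -/
theorem exists_interlacing_restrict {n k : ℕ} {P R : Matrix (Fin n) (Fin n) ℝ} (hP : P.PosDef)
    (hR : R.IsHermitian) {V : Matrix (Fin n) (Fin k) ℝ} (hV : (Vᵀ * P⁻¹ * V).PosDef)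
    {σ : Fin n → ℝ} (hσ : IsSingularValues P R σ) :
    ∃ μ, IsSingularValues (Vᵀ * P⁻¹ * V)⁻¹ (Vᵀ * R * V) μ ∧ Interlaces μ σ := by
  obtain ⟨T, σ', hT, hσ', hTP, hTR⟩ := exists_simultaneous_diagonalization hP hR
  obtain rfl := hσ.eq (.of_diagonalization hT hσ' hTP hTR) rfl
  obtain ⟨T', μ, hT', hμ, hTP', hTR'⟩ := exists_simultaneous_diagonalization
    (R := Vᵀ * R * V) hV.inv (by simpa using isHermitian_conjTranspose_mul_mul V hR)
  refine ⟨μ, .of_diagonalization hT' hμ hTP' hTR', ?_⟩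
  have hTt : IsUnit (Tᵀ).det := by rwa [det_transpose]
  have hT't : IsUnit (T'ᵀ).det := by rwa [det_transpose]
  have hY : (T⁻¹ * V * T')ᵀ * (T⁻¹ * V * T') = 1 := by
    have h1 : Vᵀ * P⁻¹ * V = T'ᵀ⁻¹ * T'⁻¹ := by
      rw [← Matrix.mul_inv_rev, hTP', nonsing_inv_nonsing_inv]
      exact (isUnit_iff_isUnit_det _).1 hV.isUnit
    calc (T⁻¹ * V * T')ᵀ * (T⁻¹ * V * T') = T'ᵀ * (Vᵀ * (Tᵀ⁻¹ * T⁻¹) * V) * T' := by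
          simp only [transpose_mul, transpose_nonsing_inv, Matrix.mul_assoc]
      _ = T'ᵀ * (T'ᵀ⁻¹ * T'⁻¹) * T' := by rw [← Matrix.mul_inv_rev, hTP, h1]
      _ = 1 := by
          rw [← Matrix.mul_assoc, mul_nonsing_inv _ hT't, Matrix.one_mul, nonsing_inv_mul _ hT']
  have hD : (T⁻¹ * V * T')ᵀ * diagonal σ * (T⁻¹ * V * T') = diagonal μ := by
    have h2 : R = Tᵀ⁻¹ * diagonal σ * T⁻¹ := by
      rw [← hTR, Matrix.mul_assoc, Matrix.mul_assoc, mul_nonsing_inv _ hT, Matrix.mul_one,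
        ← Matrix.mul_assoc, nonsing_inv_mul _ hTt, Matrix.one_mul]
    rw [← hTR', h2]
    simp only [transpose_mul, transpose_nonsing_inv, Matrix.mul_assoc]
  have hkn := Matrix.le_of_transpose_mul_self_eq_one hY
  exact ⟨hkn, fun i => ⟨(interlacing_of_isometry_diagonal hσ' hμ hY hD i _).2 rfl hkn,
    (interlacing_of_isometry_diagonal hσ' hμ hY hD i _).1 rfl⟩⟩

theorem IsSingularValues.symm {n : ℕ} {P R : Matrix (Fin n) (Fin n) ℝ} {σ : Fin n → ℝ}
    (h : IsSingularValues P R σ) : IsSingularValues R P σ :=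
  ⟨h.1, by rw [charpoly_mul_comm, h.2]⟩

/-! ### Linear Volterra equations with bounded measurable kernels -/

section Volterra

variable {E F : Type*} [NormedAddCommGroup E] [NormedSpace ℝ E] [NormedAddCommGroup F]
  [NormedSpace ℝ F]

theorem IntervalIntegrable.clm_apply_of_bounded {L : ℝ → E →L[ℝ] F} {M a b : ℝ} {w : ℝ → E}
    (hL : AEStronglyMeasurable L (volume.restrict (Set.uIoc a b))) (hM : ∀ t, ‖L t‖ ≤ M)
    (hw : IntervalIntegrable w volume a b) :
    IntervalIntegrable (fun s => L s (w s)) volume a b := by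
  rw [intervalIntegrable_iff] at *
  refine Integrable.mono' (hw.norm.const_mul M)
    (isBoundedBilinearMap_apply.continuous.comp_aestronglyMeasurable
      (hL.prodMk hw.aestronglyMeasurable)) (Eventually.of_forall fun s => ?_)
  exact (L s).le_of_opNorm_le (hM s) _

/-- This is the induction step of the Picard estimate: each integration contributes a factor `M * t
/ (k + 1)`. -/
theorem norm_integral_clm_apply_le {L : ℝ → E →L[ℝ] E} {M C t : ℝ} {w : ℝ → E} {k : ℕ}
    (ht : 0 ≤ t) (hM0 : 0 ≤ M) (hM : ∀ t, ‖L t‖ ≤ M)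
    (hw : ∀ s ∈ Set.Icc 0 t, ‖w s‖ ≤ C * ((M * s) ^ k / k.factorial)) :
    ‖∫ s in 0..t, L s (w s)‖ ≤ C * ((M * t) ^ (k + 1) / (k + 1).factorial) := by
  have h : ‖∫ s in 0..t, L s (w s)‖ ≤ ∫ s in 0..t, M * (C * ((M * s) ^ k / k.factorial)) := by
    refine intervalIntegral.norm_integral_le_of_norm_le ht (Eventually.of_forall fun s hs => ?_)
      (Continuous.intervalIntegrable (by fun_prop) _ _)
    exact ((L s).le_of_opNorm_le (hM s) _).trans
      (mul_le_mul_of_nonneg_left (hw s (Set.Ioc_subset_Icc_self hs)) hM0)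
  refine h.trans (le_of_eq ?_)
  have : (fun s : ℝ => M * (C * ((M * s) ^ k / k.factorial))) =
      fun s => (C * M ^ (k + 1) / k.factorial) * s ^ k := by
    ext s; rw [mul_pow]; ring
  rw [this, intervalIntegral.integral_const_mul, integral_pow, mul_pow, Nat.factorial_succ]
  have := Nat.factorial_ne_zero k
  push_cast
  field_simp
  simp

theorem eqOn_zero_of_eq_integral {L : ℝ → E →L[ℝ] E} {M T : ℝ} (hM : ∀ t, ‖L t‖ ≤ M)
    {z : ℝ → E} (hz : ContinuousOn z (Set.Icc 0 T))
    (hzL : ∀ t ∈ Set.Icc 0 T, z t = ∫ s in 0..t, L s (z s)) :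
    ∀ t ∈ Set.Icc 0 T, z t = 0 := by
  have hM0 : 0 ≤ M := (norm_nonneg _).trans (hM 0)
  obtain ⟨C, hC⟩ := isCompact_Icc.exists_bound_of_continuousOn hz
  have key : ∀ k : ℕ, ∀ t ∈ Set.Icc 0 T, ‖z t‖ ≤ C * ((M * t) ^ k / k.factorial) := by
    intro k
    induction k with
    | zero => intro t ht; simpa using hC t ht
    | succ k ih =>
      intro t ht
      rw [hzL t ht]
      exact norm_integral_clm_apply_le ht.1 hM0 hM fun s hs => ih s ⟨hs.1, hs.2.trans ht.2⟩
  intro t ht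
  have hlim : Tendsto (fun k : ℕ => C * ((M * t) ^ k / k.factorial)) atTop (𝓝 (C * 0)) :=
    (FloorSemiring.tendsto_pow_div_factorial_atTop (M * t)).const_mul C
  rw [mul_zero] at hlim
  exact norm_le_zero_iff.1 (ge_of_tendsto' hlim fun k => key k t ht)

theorem exists_eq_add_integral [CompleteSpace E] {L : ℝ → E →L[ℝ] E} {M : ℝ}
    (hL : AEStronglyMeasurable L volume) (hM : ∀ t, ‖L t‖ ≤ M) {y : ℝ → E} (hy : Continuous y) :
    ∃ x : ℝ → E, ContinuousOn x (Set.Ici 0) ∧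
      ∀ t, 0 ≤ t → x t = y t + ∫ s in 0..t, L s (x s) := by
  have hM0 : 0 ≤ M := (norm_nonneg _).trans (hM 0)
  -- `v k` is the `k`-th iterate of the Volterra operator applied to `y`, and the solution is the
  -- Neumann series of these terms.
  let v : ℕ → ℝ → E := fun k => Nat.rec y (fun _ w t => ∫ s in 0..t, L s (w s)) k
  have hv_cont : ∀ k, Continuous (v k) := by
    intro k
    induction k with
    | zero => exact hy
    | succ k ih =>
      exact intervalIntegral.continuous_primitive (fun a b =>
        (ih.intervalIntegrable a b).clm_apply_of_bounded hL.restrict hM) 0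
  have hv_bound : ∀ T : ℝ, ∃ C, ∀ k, ∀ t ∈ Set.Icc 0 T,
      ‖v k t‖ ≤ C * ((M * t) ^ k / k.factorial) := by
    intro T
    obtain ⟨C, hC⟩ := isCompact_Icc.exists_bound_of_continuousOn (hy.continuousOn (s := Set.Icc 0 T))
    refine ⟨C, fun k => ?_⟩
    induction k with
    | zero => intro t ht; simpa [v] using hC t ht
    | succ k ih =>
      intro t ht
      exact norm_integral_clm_apply_le ht.1 hM0 hM fun s hs => ih s ⟨hs.1, hs.2.trans ht.2⟩
  have hv_bound' : ∀ T : ℝ, ∃ C, ∀ k, ∀ t ∈ Set.Icc 0 T,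
      ‖v k t‖ ≤ C * ((M * T) ^ k / k.factorial) := by
    intro T
    obtain ⟨C, hC⟩ := hv_bound T
    refine ⟨|C|, fun k t ht => (hC k t ht).trans ?_⟩
    have h0 : 0 ≤ M * t := mul_nonneg hM0 ht.1
    refine mul_le_mul (le_abs_self C) ?_ (by positivity) (abs_nonneg _)
    gcongr
    exact ht.2
  have hsum : ∀ (C T : ℝ), Summable fun k : ℕ => C * ((M * T) ^ k / k.factorial) :=
    fun C T => (Real.summable_pow_div_factorial (M * T)).mul_left C
  have hv_sum : ∀ t, 0 ≤ t → HasSum (fun k => v k t) (∑' k, v k t) := by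
    intro t ht
    obtain ⟨C, hC⟩ := hv_bound' t
    exact (Summable.of_norm_bounded (hsum C t) fun k => hC k t ⟨ht, le_rfl⟩).hasSum
  refine ⟨fun t => ∑' k, v k t, fun t ht => ?_, fun t ht => ?_⟩
  · obtain ⟨C, hC⟩ := hv_bound' (t + 1)
    have : ContinuousOn (fun t => ∑' k, v k t) (Set.Icc 0 (t + 1)) :=
      continuousOn_tsum (fun k => (hv_cont k).continuousOn) (hsum C (t + 1)) hC
    refine (this t ⟨ht, by linarith⟩).mono_of_mem_nhdsWithin ?_
    rw [← Set.Ici_inter_Iic]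
    exact inter_mem_nhdsWithin _ (Iic_mem_nhds (by linarith))
  · obtain ⟨C, hC⟩ := hv_bound' t
    have h : HasSum (fun k => ∫ s in 0..t, L s (v k s)) (∫ s in 0..t, L s (∑' k, v k s)) := by
      refine intervalIntegral.hasSum_integral_of_dominated_convergence
        (fun k _ => M * (C * ((M * t) ^ k / k.factorial))) (fun k => ?_) (fun k => ?_) ?_ ?_ ?_
      · exact (((hv_cont k).intervalIntegrable 0 t).clm_apply_of_bounded hL.restrict
          hM).def'.aestronglyMeasurable
      · refine Eventually.of_forall fun s hs => ?_
        rw [Set.uIoc_of_le ht] at hs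
        exact ((L s).le_of_opNorm_le (hM s) _).trans
          (mul_le_mul_of_nonneg_left (hC k s (Set.Ioc_subset_Icc_self hs)) hM0)
      · exact Eventually.of_forall fun s _ => (hsum C t).mul_left M
      · exact intervalIntegrable_const
      · refine Eventually.of_forall fun s hs => ?_
        rw [Set.uIoc_of_le ht] at hs
        exact (hv_sum s hs.1.le).mapL (L s)
    -- Integrating the series shifts its index by one, so what is missing is exactly the term `v 0 =
    -- y`.
    have h' := (hasSum_nat_add_iff (f := fun k => v k t) 1).1 h
    refine ((hv_sum t ht).unique h').trans ?_
    simp [v, add_comm]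

end Volterra

/-! ### Absolutely continuous functions and their primitives -/

section AbsolutelyContinuous

variable {E : Type*} [NormedAddCommGroup E] [NormedSpace ℝ E]

/-- The increments are dominated by those of the primitive of `‖f‖`, which reduces the claim to the
real-valued case. -/
theorem IntervalIntegrable.absolutelyContinuousOnInterval_primitive {f : ℝ → E} {b : ℝ}
    (hf : IntervalIntegrable f volume 0 b) :
    AbsolutelyContinuousOnInterval (fun t => ∫ s in 0..t, f s) 0 b := by
  have h := hf.norm.absolutelyContinuousOnInterval_intervalIntegral (c := 0) Set.left_mem_uIcc
  rw [absolutelyContinuousOnInterval_iff] at h ⊢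
  intro ε hε
  obtain ⟨δ, hδ, h⟩ := h ε hε
  refine ⟨δ, hδ, fun I hI hIδ => lt_of_le_of_lt (Finset.sum_le_sum fun i hi => ?_) (h I hI hIδ)⟩
  have hmem := hI.1 i hi
  have hsub : ∀ c ∈ Set.uIcc 0 b, IntervalIntegrable f volume 0 c := fun c hc =>
    hf.mono_set (Set.uIcc_subset_uIcc Set.left_mem_uIcc hc)
  have h1 := hsub _ hmem.1
  have h2 := hsub _ hmem.2
  rw [dist_eq_norm, Real.dist_eq, intervalIntegral.integral_interval_sub_left h1 h2,
    intervalIntegral.integral_interval_sub_left h1.norm h2.norm]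
  exact intervalIntegral.norm_integral_le_abs_integral_norm

/-- The difference of `x` and the primitive of `f` is absolutely continuous with derivative zero
almost everywhere, hence constant. -/
theorem AbsolutelyContinuousOnInterval.eq_add_integral [CompleteSpace E] {f x : ℝ → E} {b : ℝ}
    (hx : AbsolutelyContinuousOnInterval x 0 b) (hf : IntervalIntegrable f volume 0 b)
    (hd : ∀ᵐ t, t ∈ Set.uIcc 0 b → HasDerivAt x (f t) t) :
    ∀ t ∈ Set.uIcc 0 b, x t = x 0 + ∫ s in 0..t, f s := by
  obtain ⟨C, hC⟩ := (hx.fun_sub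
    hf.absolutelyContinuousOnInterval_primitive).const_of_ae_hasDerivAt_zero (by
      filter_upwards [hd, hf.ae_hasDerivAt_integral] with t h1 h2 ht
      simpa using (h1 ht).fun_sub (h2 ht 0 Set.left_mem_uIcc))
  intro t ht
  have h0 := hC 0 Set.left_mem_uIcc
  have h1 := hC t ht
  simp only [intervalIntegral.integral_same, sub_zero] at h0
  rw [h0, ← h1, sub_add_cancel]

theorem AbsolutelyContinuousOnInterval.congr {E : Type*} [PseudoMetricSpace E] {f g : ℝ → E} {a b : ℝ}
    (hf : AbsolutelyContinuousOnInterval f a b) (h : Set.EqOn f g (Set.uIcc a b)) :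
    AbsolutelyContinuousOnInterval g a b := by
  rw [absolutelyContinuousOnInterval_iff] at hf ⊢
  intro ε hε
  obtain ⟨δ, hδ, hf⟩ := hf ε hε
  refine ⟨δ, hδ, fun I hI hIδ => lt_of_eq_of_lt (Finset.sum_congr rfl fun i hi => ?_) (hf I hI hIδ)⟩
  have hmem := hI.1 i hi
  rw [h hmem.1, h hmem.2]

end AbsolutelyContinuous

/-! ### Measurability of switched coefficients -/

/-- The discontinuities of `q` form a countable null set. Away from it `g ∘ q` is continuous for any
`g`, since the set of modes is discrete. -/
theorem PiecewiseContinuous.aestronglyMeasurable_comp {D : ℕ} {E : Type*} [TopologicalSpace E]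
    [TopologicalSpace.PseudoMetrizableSpace E] [SecondCountableTopology E]
    {q : ℝ → Fin D} (hq : PiecewiseContinuous q) (g : Fin D → E) :
    AEStronglyMeasurable (fun t => g (q t)) (volume.restrict (Set.Ici (0 : ℝ))) := by
  set S : Set ℝ := {t ∈ Set.Ici 0 | ¬ ContinuousWithinAt q (Set.Ici 0) t} with hS
  have hSc : S.Countable := by
    have : S ⊆ ⋃ k : ℕ, {t ∈ Set.Icc 0 (k : ℝ) | ¬ ContinuousWithinAt q (Set.Ici 0) t} := by
      rintro t ⟨ht, htc⟩
      obtain ⟨k, hk⟩ := exists_nat_ge t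
      exact Set.mem_iUnion.2 ⟨k, ⟨ht, hk⟩, htc⟩
    exact (Set.countable_iUnion fun k : ℕ => (hq.1 k).countable).mono this
  have hcont : ContinuousOn (fun t => g (q t)) (Set.Ici 0 \ S) := by
    intro t ht
    have h1 : ContinuousWithinAt q (Set.Ici 0) t := by
      by_contra h
      exact ht.2 ⟨ht.1, h⟩
    exact (continuous_of_discreteTopology (f := g)).continuousAt.comp_continuousWithinAt
      (h1.mono Set.sdiff_subset)
  have := hcont.aestronglyMeasurable (μ := volume) (measurableSet_Ici.diff hSc.measurableSet)
  rwa [Measure.restrict_congr_set (sdiff_null_ae_eq_self (hSc.measure_zero _))] at this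

/-- Multiplication by a matrix that is switched by `q`, and zero for negative times. -/
noncomputable def switchedCLM {D k l : ℕ} (G : Fin D → Matrix (Fin l) (Fin k) ℝ) (q : ℝ → Fin D) :
    ℝ → (Fin k → ℝ) →L[ℝ] (Fin l → ℝ) :=
  (Set.Ici (0 : ℝ)).indicator fun t => (G (q t)).mulVecLin.toContinuousLinearMap

section switchedCLM

variable {D k l : ℕ} (G : Fin D → Matrix (Fin l) (Fin k) ℝ) {q : ℝ → Fin D}

theorem switchedCLM_apply {t : ℝ} (ht : 0 ≤ t) (w : Fin k → ℝ) :
    switchedCLM G q t w = G (q t) *ᵥ w := by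
  simp [switchedCLM, Set.indicator_of_mem (Set.mem_Ici.2 ht)]

theorem aestronglyMeasurable_switchedCLM (hq : PiecewiseContinuous q) :
    AEStronglyMeasurable (switchedCLM G q) volume :=
  (aestronglyMeasurable_indicator_iff measurableSet_Ici).2
    (hq.aestronglyMeasurable_comp fun i => (G i).mulVecLin.toContinuousLinearMap)

theorem exists_bound_switchedCLM (q : ℝ → Fin D) : ∃ M, ∀ t, ‖switchedCLM G q t‖ ≤ M := by
  obtain ⟨M, hM⟩ := Finite.exists_le fun i => ‖(G i).mulVecLin.toContinuousLinearMap‖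
  refine ⟨M, fun t => ?_⟩
  exact (norm_indicator_le_norm_self _ _).trans (hM (q t))

theorem intervalIntegrable_switchedCLM (hq : PiecewiseContinuous q) {w : ℝ → Fin k → ℝ} {a b : ℝ}
    (hw : IntervalIntegrable w volume a b) :
    IntervalIntegrable (fun s => switchedCLM G q s (w s)) volume a b := by
  obtain ⟨M, hM⟩ := exists_bound_switchedCLM G q
  exact hw.clm_apply_of_bounded (aestronglyMeasurable_switchedCLM G hq).restrict hM

end switchedCLM

/-! ### Existence, uniqueness and continuation of continuous-time trajectories -/

namespace LSS

variable {D n m p : ℕ} (sys : LSS D n m p)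

/-- The right-hand side of the state equation along a trajectory. -/
def field (u : ℝ → Fin m → ℝ) (q : ℝ → Fin D) (x : ℝ → Fin n → ℝ) (s : ℝ) : Fin n → ℝ :=
  sys.A (q s) *ᵥ x s + sys.B (q s) *ᵥ u s

variable {sys} {u : ℝ → Fin m → ℝ} {q : ℝ → Fin D} {x : ℝ → Fin n → ℝ} {y : ℝ → Fin p → ℝ}
  {x₀ : Fin n → ℝ}

theorem field_eq_switchedCLM {s : ℝ} (hs : 0 ≤ s) :
    sys.field u q x s = switchedCLM sys.A q s (x s) +
      switchedCLM sys.B q s ((Set.Ici (0 : ℝ)).indicator u s) := by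
  rw [switchedCLM_apply _ hs, switchedCLM_apply _ hs, Set.indicator_of_mem (Set.mem_Ici.2 hs),
    field]

theorem intervalIntegrable_indicator (hu : MemLp u 2 (volume.restrict (Set.Ici (0 : ℝ)))) (a b : ℝ) :
    IntervalIntegrable ((Set.Ici (0 : ℝ)).indicator u) volume a b :=
  intervalIntegrable_iff.2 ((LocallyIntegrable.integrableOn_isCompact
    (((memLp_indicator_iff_restrict measurableSet_Ici).2 hu).locallyIntegrable (by norm_num))
    isCompact_uIcc).mono_set Set.uIoc_subset_uIcc)

theorem uIcc_subset_Ici {a b : ℝ} (ha : 0 ≤ a) (hb : 0 ≤ b) : Set.uIcc a b ⊆ Set.Ici 0 :=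
  fun _ hs => (le_inf ha hb).trans hs.1

theorem intervalIntegrable_field (hu : MemLp u 2 (volume.restrict (Set.Ici (0 : ℝ))))
    (hq : PiecewiseContinuous q) (hx : ContinuousOn x (Set.Ici 0)) {a b : ℝ} (ha : 0 ≤ a)
    (hb : 0 ≤ b) : IntervalIntegrable (sys.field u q x) volume a b := by
  have h := (intervalIntegrable_switchedCLM sys.A hq
    (hx.mono (uIcc_subset_Ici ha hb)).intervalIntegrable).add
    (intervalIntegrable_switchedCLM sys.B hq (intervalIntegrable_indicator hu a b))
  refine h.congr fun s hs => ?_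
  exact (field_eq_switchedCLM (uIcc_subset_Ici ha hb (Set.uIoc_subset_uIcc hs))).symm

/-- The integral equation is the form to which the Volterra results apply and which linear maps
visibly preserve. -/
theorem isSolutionCont_iff (hu : MemLp u 2 (volume.restrict (Set.Ici (0 : ℝ))))
    (hq : PiecewiseContinuous q) :
    sys.IsSolutionCont x₀ u q x y ↔
      (ContinuousOn x (Set.Ici 0) ∧ ∀ t, 0 ≤ t → x t = x₀ + ∫ s in 0..t, sys.field u q x s) ∧
        ∀ t, 0 ≤ t → y t = sys.C (q t) *ᵥ x t := by
  constructor
  · rintro ⟨hac, h0, hd, hy⟩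
    have hcont : ContinuousOn x (Set.Ici 0) := fun t ht => by
      have hb : (0 : ℝ) ≤ t + 1 := by linarith [Set.mem_Ici.1 ht]
      have h := (hac (t + 1) hb).continuousOn
      rw [Set.uIcc_of_le hb] at h
      refine (h t ⟨ht, by linarith⟩).mono_of_mem_nhdsWithin ?_
      rw [← Set.Ici_inter_Iic]
      exact inter_mem_nhdsWithin _ (Iic_mem_nhds (by linarith))
    refine ⟨⟨hcont, fun t ht => ?_⟩, hy⟩
    rw [← h0]
    refine (hac t ht).eq_add_integral (intervalIntegrable_field hu hq hcont le_rfl ht) ?_ t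
      Set.right_mem_uIcc
    rw [ae_restrict_iff' measurableSet_Ici] at hd
    filter_upwards [hd] with s hs hs'
    exact hs (uIcc_subset_Ici le_rfl ht hs')
  · rintro ⟨⟨hcont, hx⟩, hy⟩
    have hint := fun t (ht : (0 : ℝ) ≤ t) =>
      intervalIntegrable_field (sys := sys) hu hq hcont le_rfl ht
    refine ⟨fun b hb => ?_, by simpa using hx 0 le_rfl, ?_, hy⟩
    · have h : AbsolutelyContinuousOnInterval
          (fun t => x₀ + ∫ s in 0..t, sys.field u q x s) 0 b := by
        have hc : AbsolutelyContinuousOnInterval (fun _ : ℝ => x₀) 0 b := by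
          rw [absolutelyContinuousOnInterval_iff]
          exact fun ε hε => ⟨1, one_pos, fun I _ _ => by simpa using hε⟩
        exact hc.fun_add (hint b hb).absolutelyContinuousOnInterval_primitive
      exact h.congr fun t ht => (hx t (uIcc_subset_Ici le_rfl hb ht)).symm
    · rw [ae_restrict_iff' measurableSet_Ici]
      -- Exhausting the half-line by the intervals `[0, k]` leaves a single null set that serves all
      -- times.
      have hall : ∀ᵐ t, ∀ k : ℕ, t ∈ Set.uIcc (0 : ℝ) k → ∀ c ∈ Set.uIcc (0 : ℝ) k,
          HasDerivAt (fun t => ∫ s in c..t, sys.field u q x s) (sys.field u q x t) t :=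
        ae_all_iff.2 fun k => (hint k k.cast_nonneg).ae_hasDerivAt_integral
      -- Time `0` is discarded because the derivative is two-sided and `x` is unconstrained at
      -- negative times.
      filter_upwards [hall, compl_mem_ae_iff.2 (measure_singleton (0 : ℝ))] with t ht ht0 htpos
      obtain ⟨k, hk⟩ := exists_nat_ge t
      have htk : t ∈ Set.uIcc (0 : ℝ) k := by
        rw [Set.uIcc_of_le k.cast_nonneg]; exact ⟨htpos, hk⟩
      have h := (ht k htk 0 Set.left_mem_uIcc).const_add x₀
      refine h.congr_of_eventuallyEq ?_
      filter_upwards [Ioi_mem_nhds (lt_of_le_of_ne htpos (Ne.symm ht0))] with s hs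
      exact hx s (le_of_lt hs)

theorem exists_isSolutionCont (sys : LSS D n m p) (x₀ : Fin n → ℝ)
    (hu : MemLp u 2 (volume.restrict (Set.Ici (0 : ℝ)))) (hq : PiecewiseContinuous q) :
    ∃ x, sys.IsSolutionCont x₀ u q x (fun t => sys.C (q t) *ᵥ x t) := by
  obtain ⟨M, hM⟩ := exists_bound_switchedCLM sys.A q
  have hB := fun a b => intervalIntegrable_switchedCLM sys.B hq (intervalIntegrable_indicator hu a b)
  obtain ⟨x, hxc, hx⟩ := exists_eq_add_integral (aestronglyMeasurable_switchedCLM sys.A hq) hM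
    (y := fun t => x₀ + ∫ s in 0..t, switchedCLM sys.B q s ((Set.Ici (0 : ℝ)).indicator u s))
    (continuous_const.add (intervalIntegral.continuous_primitive hB 0))
  refine ⟨x, (isSolutionCont_iff hu hq).2 ⟨⟨hxc, fun t ht => ?_⟩, fun _ _ => rfl⟩⟩
  have hA := intervalIntegrable_switchedCLM sys.A hq
    (hxc.mono (uIcc_subset_Ici le_rfl ht)).intervalIntegrable
  rw [hx t ht, add_assoc, ← intervalIntegral.integral_add (hB 0 t) hA]
  congr 1
  refine intervalIntegral.integral_congr fun s hs => ?_
  rw [field_eq_switchedCLM (uIcc_subset_Ici le_rfl ht hs), add_comm]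

/-- Trajectories depend only on the past of the input and of the switching signal. -/
theorem IsSolutionCont.eqOn {u' : ℝ → Fin m → ℝ} {q' : ℝ → Fin D} {x' : ℝ → Fin n → ℝ}
    {y' : ℝ → Fin p → ℝ} {T : ℝ}
    (hu : MemLp u 2 (volume.restrict (Set.Ici (0 : ℝ)))) (hq : PiecewiseContinuous q)
    (hu' : MemLp u' 2 (volume.restrict (Set.Ici (0 : ℝ)))) (hq' : PiecewiseContinuous q')
    (h : sys.IsSolutionCont x₀ u q x y) (h' : sys.IsSolutionCont x₀ u' q' x' y')
    (huu : ∀ t ∈ Set.Ico 0 T, u t = u' t) (hqq : ∀ t ∈ Set.Ico 0 T, q t = q' t) :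
    ∀ t ∈ Set.Icc 0 T, x t = x' t := by
  obtain ⟨⟨hc, hx⟩, -⟩ := (isSolutionCont_iff hu hq).1 h
  obtain ⟨⟨hc', hx'⟩, -⟩ := (isSolutionCont_iff hu' hq').1 h'
  obtain ⟨M, hM⟩ := exists_bound_switchedCLM sys.A q
  -- On `[0, T]` the input terms cancel, so the difference solves the homogeneous Volterra equation.
  -- The signals may disagree at `T` itself, which is a null set.
  have key := eqOn_zero_of_eq_integral (T := T) (z := fun t => x t - x' t) hM
    ((hc.sub hc').mono Set.Icc_subset_Ici_self) ?_
  · exact fun t ht => sub_eq_zero.1 (key t ht)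
  · intro t ht
    rw [hx t ht.1, hx' t ht.1, add_sub_add_left_eq_sub, ← intervalIntegral.integral_sub
      (intervalIntegrable_field hu hq hc le_rfl ht.1)
      (intervalIntegrable_field hu' hq' hc' le_rfl ht.1)]
    refine intervalIntegral.integral_congr_ae ?_
    filter_upwards [compl_mem_ae_iff.2 (measure_singleton T)] with s hsT hs
    rw [Set.uIoc_of_le ht.1] at hs
    have hs' : s ∈ Set.Ico 0 T := ⟨hs.1.le, lt_of_le_of_ne (hs.2.trans ht.2) hsT⟩
    rw [switchedCLM_apply _ hs.1.le, field, field, huu s hs', hqq s hs', mulVec_sub]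
    abel

end LSS

theorem PiecewiseContinuous.switch {E : Type*} [TopologicalSpace E] {q : ℝ → E}
    (hq : PiecewiseContinuous q) (T : ℝ) (c : E) :
    PiecewiseContinuous fun t => if t < T then q t else c := by
  have hlt : ∀ t, t < T → (fun t => if t < T then q t else c) =ᶠ[𝓝 t] q := fun t ht => by
    filter_upwards [Iio_mem_nhds ht] with s hs
    exact if_pos hs
  have hgt : ∀ t, T < t → (fun t => if t < T then q t else c) =ᶠ[𝓝 t] fun _ => c := fun t ht => by
    filter_upwards [Ioi_mem_nhds ht] with s hs
    exact if_neg (not_lt_of_gt hs)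
  refine ⟨fun b => ?_, fun t ht => ?_, fun t ht => ?_⟩
  · refine ((hq.1 b).union (Set.finite_singleton T)).subset ?_
    rintro t ⟨ht, hc⟩
    rcases lt_trichotomy t T with h | h | h
    · refine Or.inl ⟨ht, fun h' => hc ?_⟩
      exact h'.congr_of_eventuallyEq ((hlt t h).filter_mono nhdsWithin_le_nhds) (hlt t h).eq_of_nhds
    · exact Or.inr h
    · exact (hc (continuousWithinAt_const.congr_of_eventuallyEq
        ((hgt t h).filter_mono nhdsWithin_le_nhds) (hgt t h).eq_of_nhds)).elim
  · rcases le_or_gt t T with h | h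
    · obtain ⟨l, hl⟩ := hq.2.1 t ht
      refine ⟨l, hl.congr' ?_⟩
      filter_upwards [self_mem_nhdsWithin] with s hs
      exact (if_pos (lt_of_lt_of_le hs h)).symm
    · exact ⟨c, tendsto_const_nhds.congr' ((hgt t h).symm.filter_mono nhdsWithin_le_nhds)⟩
  · rcases lt_or_ge t T with h | h
    · obtain ⟨l, hl⟩ := hq.2.2 t ht
      exact ⟨l, hl.congr' ((hlt t h).symm.filter_mono nhdsWithin_le_nhds)⟩
    · refine ⟨c, tendsto_const_nhds.congr' ?_⟩
      filter_upwards [self_mem_nhdsWithin] with s hs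
      exact (if_neg (not_lt_of_ge (h.trans (le_of_lt hs)))).symm

theorem PiecewiseContinuous.const {E : Type*} [TopologicalSpace E] (c : E) :
    PiecewiseContinuous fun _ : ℝ => c :=
  ⟨fun b => by simp [continuousWithinAt_const], fun _ _ => ⟨c, tendsto_const_nhds⟩,
    fun _ _ => ⟨c, tendsto_const_nhds⟩⟩

/-- Any input and switching signal can be continued from time `T` on with a constant mode and,
for one unit of time, with a constant input. -/
theorem exists_continuation {D m : ℕ} {u : ℝ → Fin m → ℝ} {q : ℝ → Fin D}
    (hu : MemLp u 2 (volume.restrict (Set.Ici (0 : ℝ)))) (hq : PiecewiseContinuous q)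
    (T : ℝ) (i : Fin D) (v : Fin m → ℝ) :
    ∃ (u' : ℝ → Fin m → ℝ) (q' : ℝ → Fin D), MemLp u' 2 (volume.restrict (Set.Ici (0 : ℝ))) ∧
      PiecewiseContinuous q' ∧ (∀ t ∈ Set.Ico 0 T, u t = u' t) ∧ (∀ t ∈ Set.Ico 0 T, q t = q' t) ∧
      (∀ t ∈ Set.Ico T (T + 1), u' t = v) ∧ ∀ t ∈ Set.Ico T (T + 1), q' t = i := by
  refine ⟨(Set.Iio T).indicator u + (Set.Ico T (T + 1)).indicator fun _ => v,
    fun t => if t < T then q t else i, ?_, hq.switch T i, ?_, ?_, ?_, ?_⟩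
  · refine (hu.indicator measurableSet_Iio).add (memLp_indicator_const 2 measurableSet_Ico v
      (Or.inr (ne_of_lt ?_)))
    exact (Measure.restrict_apply_le _ _).trans_lt (by simp)
  · intro t ht
    simp [ht.2]
  · intro t ht
    simp [ht.2]
  · intro t ht
    simp [ht.1, ht.2]
  · intro t ht
    simp [ht.1]

/-! ### Trajectories under morphisms, and equivalence -/

namespace LSS

variable {D n n₁ n₂ m p : ℕ}

section Continuous

variable {sys : LSS D n m p} {u : ℝ → Fin m → ℝ} {q : ℝ → Fin D} {x : ℝ → Fin n → ℝ}
  {y : ℝ → Fin p → ℝ} {x₀ : Fin n → ℝ}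

theorem IsSolutionCont.map {sys₁ : LSS D n₁ m p} {sys₂ : LSS D n₂ m p}
    {T : Matrix (Fin n₂) (Fin n₁) ℝ} (hT : IsMorphism T sys₁ sys₂)
    (hu : MemLp u 2 (volume.restrict (Set.Ici (0 : ℝ)))) (hq : PiecewiseContinuous q)
    {x : ℝ → Fin n₁ → ℝ} {x₀ : Fin n₁ → ℝ} (h : sys₁.IsSolutionCont x₀ u q x y) :
    sys₂.IsSolutionCont (T *ᵥ x₀) u q (fun t => T *ᵥ x t) y := by
  rw [isSolutionCont_iff hu hq] at h ⊢
  obtain ⟨⟨hc, hx⟩, hy⟩ := h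
  have hf : ∀ s, sys₂.field u q (fun t => T *ᵥ x t) s =
      T.mulVecLin.toContinuousLinearMap (sys₁.field u q x s) := fun s => by
    simp [field, mulVec_mulVec, mulVec_add, (hT (q s)).1, (hT (q s)).2.1]
  refine ⟨⟨(T.mulVecLin.toContinuousLinearMap.continuous.comp_continuousOn hc), fun t ht => ?_⟩,
    fun t ht => ?_⟩
  · simp only [hf]
    rw [ContinuousLinearMap.intervalIntegral_comp_comm _
      (intervalIntegrable_field hu hq hc le_rfl ht), hx t ht, mulVec_add]
    rfl
  · rw [hy t ht, mulVec_mulVec, (hT (q t)).2.2]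

/-- Constant signals just after `T` make the right-hand side right-continuous at `T`. The state
equation then holds at this prescribed time, not merely at almost every time. -/
theorem IsSolutionCont.hasDerivWithinAt
    (hu : MemLp u 2 (volume.restrict (Set.Ici (0 : ℝ)))) (hq : PiecewiseContinuous q)
    (h : sys.IsSolutionCont x₀ u q x y) {T : ℝ} (hT : 0 ≤ T) {i : Fin D} {v : Fin m → ℝ}
    (huv : ∀ t ∈ Set.Ico T (T + 1), u t = v) (hqi : ∀ t ∈ Set.Ico T (T + 1), q t = i) :
    HasDerivWithinAt x (sys.A i *ᵥ x T + sys.B i *ᵥ v) (Set.Ici T) T := by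
  obtain ⟨⟨hc, hx⟩, -⟩ := (isSolutionCont_iff hu hq).1 h
  have hf : ∀ t ∈ Set.Ico T (T + 1), sys.field u q x t = sys.A i *ᵥ x t + sys.B i *ᵥ v :=
    fun t ht => by rw [field, huv t ht, hqi t ht]
  have hTm : T ∈ Set.Ico T (T + 1) := ⟨le_rfl, by linarith⟩
  have hcT : ContinuousWithinAt (sys.field u q x) (Set.Ici T) T := by
    have h1 : ContinuousWithinAt (fun t => sys.A i *ᵥ x t + sys.B i *ᵥ v) (Set.Ici T) T :=
      ((sys.A i).mulVecLin.toContinuousLinearMap.continuous.continuousAt.comp_continuousWithinAt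
        ((hc T hT).mono (Set.Ici_subset_Ici.2 hT))).add continuousWithinAt_const
    refine h1.congr_of_eventuallyEq ?_ (hf T hTm)
    filter_upwards [Ico_mem_nhdsGE hTm.2] with s hs using hf s hs
  have hmeas : StronglyMeasurableAtFilter (sys.field u q x) (𝓝[>] T) volume := by
    refine ⟨Set.uIoc T (T + 1), ?_, (intervalIntegrable_field hu hq hc hT
      (by linarith)).def'.aestronglyMeasurable⟩
    rw [Set.uIoc_of_le (by linarith)]
    exact Ioc_mem_nhdsGT hTm.2
  have hd := intervalIntegral.integral_hasDerivWithinAt_right (s := Set.Ici T) (t := Set.Ioi T)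
    (intervalIntegrable_field hu hq hc le_rfl hT) hmeas (hcT.mono Set.Ioi_subset_Ici_self)
  rw [hf T hTm] at hd
  exact (hd.const_add x₀).congr (fun t ht => hx t (hT.trans ht)) (hx T hT)

end Continuous

section Discrete

variable {sys : LSS D n m p} {u : ℕ → Fin m → ℝ} {q : ℕ → Fin D} {x : ℕ → Fin n → ℝ}
  {y : ℕ → Fin p → ℝ} {x₀ : Fin n → ℝ}

theorem exists_isSolutionDisc (sys : LSS D n m p) (x₀ : Fin n → ℝ) (u : ℕ → Fin m → ℝ)
    (q : ℕ → Fin D) : ∃ x, sys.IsSolutionDisc x₀ u q x (fun t => sys.C (q t) *ᵥ x t) :=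
  ⟨fun t => Nat.rec x₀ (fun t x => sys.A (q t) *ᵥ x + sys.B (q t) *ᵥ u t) t, rfl, fun _ => rfl,
    fun _ => rfl⟩

theorem IsSolutionDisc.eqOn {u' : ℕ → Fin m → ℝ} {q' : ℕ → Fin D} {x' : ℕ → Fin n → ℝ}
    {y' : ℕ → Fin p → ℝ} {T : ℕ} (h : sys.IsSolutionDisc x₀ u q x y)
    (h' : sys.IsSolutionDisc x₀ u' q' x' y') (huu : ∀ t < T, u t = u' t)
    (hqq : ∀ t < T, q t = q' t) : ∀ t ≤ T, x t = x' t := by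
  intro t
  induction t with
  | zero => intro _; rw [h.1, h'.1]
  | succ t ih =>
    intro ht
    rw [h.2.1, h'.2.1, huu t ht, hqq t ht, ih (Nat.le_of_succ_le ht)]

theorem IsSolutionDisc.map {sys₁ : LSS D n₁ m p} {sys₂ : LSS D n₂ m p}
    {T : Matrix (Fin n₂) (Fin n₁) ℝ} (hT : IsMorphism T sys₁ sys₂)
    {x : ℕ → Fin n₁ → ℝ} {x₀ : Fin n₁ → ℝ} (h : sys₁.IsSolutionDisc x₀ u q x y) :
    sys₂.IsSolutionDisc (T *ᵥ x₀) u q (fun t => T *ᵥ x t) y := by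
  obtain ⟨h0, hx, hy⟩ := h
  refine ⟨congrArg T.mulVec h0, fun t => ?_, fun t => ?_⟩
  · simp [hx, mulVec_mulVec, mulVec_add, (hT (q t)).1, (hT (q t)).2.1]
  · rw [hy t, mulVec_mulVec, (hT (q t)).2.2]

theorem _root_.Memℓp.update {u : ℕ → Fin m → ℝ} (hu : Memℓp u 2) (T : ℕ) (v : Fin m → ℝ) :
    Memℓp (Function.update u T v) 2 := by
  have h : Memℓp (Pi.single T (v - u T) : ℕ → Fin m → ℝ) 2 := by
    refine Memℓp.of_exponent_ge (memℓp_zero ?_) zero_le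
    refine (Set.finite_singleton T).subset fun t ht => ?_
    by_contra hne
    exact ht (Pi.single_eq_of_ne hne _)
  convert hu.add h using 1
  ext t : 1
  rcases eq_or_ne t T with rfl | hne
  · simp
  · simp [hne]

end Discrete

theorem Equivalent.symm {τ : TimeKind} {sys₁ : LSS D n₁ m p} {sys₂ : LSS D n₂ m p}
    (h : sys₁.Equivalent τ sys₂) : sys₂.Equivalent τ sys₁ := by
  cases τ <;> exact Eq.symm h

/-- A morphism maps zero to zero and trajectories to trajectories. Uniqueness of trajectories gives
the reverse inclusion, so `T` need not be injective or surjective. -/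
theorem IsMorphism.equivalent (τ : TimeKind) {sys₁ : LSS D n₁ m p} {sys₂ : LSS D n₂ m p}
    {T : Matrix (Fin n₂) (Fin n₁) ℝ} (hT : IsMorphism T sys₁ sys₂) :
    sys₁.Equivalent τ sys₂ := by
  cases τ with
  | continuous =>
    refine Set.Subset.antisymm ?_ ?_
    · rintro ⟨u, q, y⟩ ⟨hu, hq, x, hx⟩
      exact ⟨hu, hq, _, by simpa using hx.map hT hu hq⟩
    · rintro ⟨u, q, y⟩ ⟨hu, hq, x, hx⟩
      obtain ⟨x₁, hx₁⟩ := exists_isSolutionCont sys₁ 0 hu hq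
      refine ⟨hu, hq, x₁, hx₁.1, hx₁.2.1, hx₁.2.2.1, fun t ht => ?_⟩
      have h := hx₁.map hT hu hq
      rw [mulVec_zero] at h
      have e := hx.eqOn hu hq hu hq h (T := t) (fun _ _ => rfl) (fun _ _ => rfl) t ⟨ht, le_rfl⟩
      rw [hx.2.2.2 t ht, e, mulVec_mulVec, (hT (q t)).2.2]
  | discrete =>
    refine Set.Subset.antisymm ?_ ?_
    · rintro ⟨u, q, y⟩ ⟨hu, x, hx⟩
      exact ⟨hu, _, by simpa using hx.map hT⟩
    · rintro ⟨u, q, y⟩ ⟨hu, x, hx⟩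
      obtain ⟨x₁, hx₁⟩ := exists_isSolutionDisc sys₁ 0 u q
      refine ⟨hu, x₁, hx₁.1, hx₁.2.1, fun t => ?_⟩
      have h := hx₁.map hT
      rw [mulVec_zero] at h
      have e := hx.eqOn h (T := t) (fun _ _ => rfl) (fun _ _ => rfl) t le_rfl
      rw [hx.2.2 t, e, mulVec_mulVec, (hT (q t)).2.2]

/-! ### Joint reachability of two systems -/

/-- The pairs of states that two systems, both started at zero, reach at the same time under the
same input and switching signal. -/
def jointReach (τ : TimeKind) (sys₁ : LSS D n₁ m p) (sys₂ : LSS D n₂ m p) :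
    Set ((Fin n₁ → ℝ) × (Fin n₂ → ℝ)) :=
  match τ with
  | .continuous => {z | ∃ (u : ℝ → Fin m → ℝ) (q : ℝ → Fin D) (T : ℝ) (x₁ : ℝ → Fin n₁ → ℝ)
      (y₁ : ℝ → Fin p → ℝ) (x₂ : ℝ → Fin n₂ → ℝ) (y₂ : ℝ → Fin p → ℝ),
      0 ≤ T ∧ MemLp u 2 (volume.restrict (Set.Ici (0 : ℝ))) ∧ PiecewiseContinuous q ∧
      sys₁.IsSolutionCont 0 u q x₁ y₁ ∧ sys₂.IsSolutionCont 0 u q x₂ y₂ ∧ z = (x₁ T, x₂ T)}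
  | .discrete => {z | ∃ (u : ℕ → Fin m → ℝ) (q : ℕ → Fin D) (T : ℕ) (x₁ : ℕ → Fin n₁ → ℝ)
      (y₁ : ℕ → Fin p → ℝ) (x₂ : ℕ → Fin n₂ → ℝ) (y₂ : ℕ → Fin p → ℝ),
      Memℓp u 2 ∧ sys₁.IsSolutionDisc 0 u q x₁ y₁ ∧ sys₂.IsSolutionDisc 0 u q x₂ y₂ ∧
      z = (x₁ T, x₂ T)}

variable {τ : TimeKind} {sys₁ : LSS D n₁ m p} {sys₂ : LSS D n₂ m p}

theorem zero_mem_jointReach (i : Fin D) : 0 ∈ jointReach τ sys₁ sys₂ := by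
  cases τ with
  | continuous =>
    have hq := PiecewiseContinuous.const i
    have hu : MemLp (0 : ℝ → Fin m → ℝ) 2 (volume.restrict (Set.Ici (0 : ℝ))) := MemLp.zero
    obtain ⟨x₁, h₁⟩ := exists_isSolutionCont sys₁ 0 hu hq
    obtain ⟨x₂, h₂⟩ := exists_isSolutionCont sys₂ 0 hu hq
    exact ⟨_, _, 0, x₁, _, x₂, _, le_rfl, hu, hq, h₁, h₂, by rw [h₁.2.1, h₂.2.1]; rfl⟩
  | discrete =>
    obtain ⟨x₁, h₁⟩ := exists_isSolutionDisc sys₁ 0 0 fun _ => i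
    obtain ⟨x₂, h₂⟩ := exists_isSolutionDisc sys₂ 0 0 fun _ => i
    exact ⟨_, _, 0, x₁, _, x₂, _, zero_memℓp, h₁, h₂, by rw [h₁.1, h₂.1]; rfl⟩

/-- In discrete time the pair is reached one step later. In continuous time it is the joint velocity
after switching to mode `i` and input `v`: a limit of difference quotients of reachable pairs, and a
finite-dimensional span is closed. -/
theorem step_mem_span_jointReach {z : (Fin n₁ → ℝ) × (Fin n₂ → ℝ)}
    (hz : z ∈ jointReach τ sys₁ sys₂) (i : Fin D) (v : Fin m → ℝ) :
    (sys₁.A i *ᵥ z.1 + sys₁.B i *ᵥ v, sys₂.A i *ᵥ z.2 + sys₂.B i *ᵥ v) ∈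
      Submodule.span ℝ (jointReach τ sys₁ sys₂) := by
  cases τ with
  | continuous =>
    obtain ⟨u, q, T, x₁, y₁, x₂, y₂, hT, hu, hq, h₁, h₂, rfl⟩ := hz
    obtain ⟨u', q', hu', hq', huu, hqq, huv, hqi⟩ := exists_continuation hu hq T i v
    obtain ⟨x₁', h₁'⟩ := exists_isSolutionCont sys₁ 0 hu' hq'
    obtain ⟨x₂', h₂'⟩ := exists_isSolutionCont sys₂ 0 hu' hq'
    have e₁ := h₁.eqOn hu hq hu' hq' h₁' huu hqq T ⟨hT, le_rfl⟩
    have e₂ := h₂.eqOn hu hq hu' hq' h₂' huu hqq T ⟨hT, le_rfl⟩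
    have hd := (h₁'.hasDerivWithinAt hu' hq' hT huv hqi).prodMk
      (h₂'.hasDerivWithinAt hu' hq' hT huv hqi)
    simp only [e₁, e₂]
    have hmem : ∀ t, T ≤ t → (x₁' t, x₂' t) ∈
        Submodule.span ℝ (jointReach .continuous sys₁ sys₂) := fun t ht =>
      Submodule.subset_span ⟨u', q', t, x₁', _, x₂', _, hT.trans ht, hu', hq', h₁', h₂', rfl⟩
    have hlim := hasDerivWithinAt_iff_tendsto_slope.1 hd
    rw [Set.Ici_sdiff_left] at hlim
    refine (Submodule.closed_of_finiteDimensional _).mem_of_tendsto hlim ?_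
    filter_upwards [self_mem_nhdsWithin] with t ht
    rw [slope_def_module]
    exact Submodule.smul_mem _ _ (Submodule.sub_mem _ (hmem t (le_of_lt ht)) (hmem T le_rfl))
  | discrete =>
    obtain ⟨u, q, T, x₁, y₁, x₂, y₂, hu, h₁, h₂, rfl⟩ := hz
    obtain ⟨x₁', h₁'⟩ := exists_isSolutionDisc sys₁ 0 (Function.update u T v)
      (Function.update q T i)
    obtain ⟨x₂', h₂'⟩ := exists_isSolutionDisc sys₂ 0 (Function.update u T v)
      (Function.update q T i)
    have huu : ∀ t < T, u t = Function.update u T v t := fun t ht => by simp [ht.ne]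
    have hqq : ∀ t < T, q t = Function.update q T i t := fun t ht => by simp [ht.ne]
    have e₁ := h₁.eqOn h₁' huu hqq T le_rfl
    have e₂ := h₂.eqOn h₂' huu hqq T le_rfl
    refine Submodule.subset_span ⟨_, _, T + 1, x₁', _, x₂', _, hu.update T v, h₁', h₂', ?_⟩
    rw [h₁'.2.1, h₂'.2.1]
    simp [e₁, e₂]

/-- Switching to mode `i` exactly at time `T` leaves the states at `T` unchanged, but the output is
already read through `C i`. -/
theorem Equivalent.output_eq_of_mem_jointReach (h : sys₁.Equivalent τ sys₂)
    {z : (Fin n₁ → ℝ) × (Fin n₂ → ℝ)} (hz : z ∈ jointReach τ sys₁ sys₂) (i : Fin D) :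
    sys₁.C i *ᵥ z.1 = sys₂.C i *ᵥ z.2 := by
  cases τ with
  | continuous =>
    obtain ⟨u, q, T, x₁, y₁, x₂, y₂, hT, hu, hq, h₁, h₂, rfl⟩ := hz
    obtain ⟨u', q', hu', hq', huu, hqq, huv, hqi⟩ := exists_continuation hu hq T i 0
    obtain ⟨x₁', h₁'⟩ := exists_isSolutionCont sys₁ 0 hu' hq'
    have hg : (u', q', fun t => sys₁.C (q' t) *ᵥ x₁' t) ∈ sys₁.ioGraphCont 0 :=
      ⟨hu', hq', x₁', h₁'⟩
    rw [show sys₁.ioGraphCont 0 = sys₂.ioGraphCont 0 from h] at hg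
    obtain ⟨-, -, x₂', h₂'⟩ := hg
    have e₁ := h₁.eqOn hu hq hu' hq' h₁' huu hqq T ⟨hT, le_rfl⟩
    have e₂ := h₂.eqOn hu hq hu' hq' h₂' huu hqq T ⟨hT, le_rfl⟩
    have hy := h₂'.2.2.2 T hT
    simp only at hy
    rw [hqi T ⟨le_rfl, by linarith⟩] at hy
    rw [e₁, e₂, hy]
  | discrete =>
    obtain ⟨u, q, T, x₁, y₁, x₂, y₂, hu, h₁, h₂, rfl⟩ := hz
    obtain ⟨x₁', h₁'⟩ := exists_isSolutionDisc sys₁ 0 u (Function.update q T i)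
    have hg : (u, Function.update q T i, fun t => sys₁.C (Function.update q T i t) *ᵥ x₁' t) ∈
        sys₁.ioGraphDisc 0 := ⟨hu, x₁', h₁'⟩
    rw [show sys₁.ioGraphDisc 0 = sys₂.ioGraphDisc 0 from h] at hg
    obtain ⟨-, x₂', h₂'⟩ := hg
    have hqq : ∀ t < T, q t = Function.update q T i t := fun t ht => by simp [ht.ne]
    have e₁ := h₁.eqOn h₁' (fun _ _ => rfl) hqq T le_rfl
    have e₂ := h₂.eqOn h₂' (fun _ _ => rfl) hqq T le_rfl
    have hy := h₂'.2.2 T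
    simp only [Function.update_self] at hy
    rw [e₁, e₂, hy]

end LSS

/-! ### Minimal systems: reachability, observability, subquotients -/

namespace LSS

variable {D n n₁ n₂ m p : ℕ}

section OfLinearMaps

variable {X : Type*} [AddCommGroup X] [Module ℝ X] {l : ℕ} (e : X ≃ₗ[ℝ] (Fin l → ℝ))
  (a : Fin D → X →ₗ[ℝ] X) (b : Fin D → (Fin m → ℝ) →ₗ[ℝ] X) (c : Fin D → X →ₗ[ℝ] (Fin p → ℝ))

/-- The system given in coordinates by linear maps on an abstract state space. -/
noncomputable def ofLinearMaps : LSS D l m p where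
  A q := LinearMap.toMatrix' (e.toLinearMap ∘ₗ a q ∘ₗ e.symm.toLinearMap)
  B q := LinearMap.toMatrix' (e.toLinearMap ∘ₗ b q)
  C q := LinearMap.toMatrix' (c q ∘ₗ e.symm.toLinearMap)

variable {a b c} {sys : LSS D n m p}

theorem isMorphism_from_ofLinearMaps {f : X →ₗ[ℝ] (Fin n → ℝ)}
    (hA : ∀ q z, f (a q z) = sys.A q *ᵥ f z) (hB : ∀ q v, f (b q v) = sys.B q *ᵥ v)
    (hC : ∀ q z, sys.C q *ᵥ f z = c q z) :
    IsMorphism (LinearMap.toMatrix' (f ∘ₗ e.symm.toLinearMap)) (ofLinearMaps e a b c) sys := by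
  intro q
  refine ⟨?_, ?_, ?_⟩ <;> apply Matrix.toLin'.injective <;> ext1 v <;> ext1
  · simp [ofLinearMaps, Matrix.toLin'_mul, ← hA]
  · simp [ofLinearMaps, Matrix.toLin'_mul, hB]
  · simp [ofLinearMaps, Matrix.toLin'_mul, hC]

theorem isMorphism_to_ofLinearMaps {f : (Fin n → ℝ) →ₗ[ℝ] X}
    (hA : ∀ q z, f (sys.A q *ᵥ z) = a q (f z)) (hB : ∀ q v, f (sys.B q *ᵥ v) = b q v)
    (hC : ∀ q z, sys.C q *ᵥ z = c q (f z)) :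
    IsMorphism (LinearMap.toMatrix' (e.toLinearMap ∘ₗ f)) sys (ofLinearMaps e a b c) := by
  intro q
  refine ⟨?_, ?_, ?_⟩ <;> apply Matrix.toLin'.injective <;> ext1 v <;> ext1
  · simp [ofLinearMaps, Matrix.toLin'_mul, ← hA]
  · simp [ofLinearMaps, Matrix.toLin'_mul, ← hB]
  · simp [ofLinearMaps, Matrix.toLin'_mul, hC]

end OfLinearMaps

/-- The restriction of the system to `W` is equivalent to it and has dimension `finrank W`. -/
theorem IsMinimal.reachable {τ : TimeKind} {sys : LSS D n m p} (h : sys.IsMinimal τ)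
    (W : Submodule ℝ (Fin n → ℝ)) (hA : ∀ q, ∀ z ∈ W, sys.A q *ᵥ z ∈ W)
    (hB : ∀ q v, sys.B q *ᵥ v ∈ W) : W = ⊤ := by
  have hm := isMorphism_from_ofLinearMaps (sys := sys) (Module.finBasis ℝ W).equivFun
    (a := fun q => (sys.A q).mulVecLin.restrict (hA q))
    (b := fun q => (sys.B q).mulVecLin.codRestrict W (hB q))
    (c := fun q => (sys.C q).mulVecLin ∘ₗ W.subtype) (f := W.subtype)
    (fun _ _ => rfl) (fun _ _ => rfl) (fun _ _ => rfl)
  refine Submodule.eq_top_of_finrank_eq (le_antisymm (Submodule.finrank_le W) ?_)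
  simpa using h _ _ (hm.equivalent τ)

/-- The quotient of the system by `W` is equivalent to it, so minimality forbids any loss of
dimension. -/
theorem IsMinimal.observable {τ : TimeKind} {sys : LSS D n m p} (h : sys.IsMinimal τ)
    (W : Submodule ℝ (Fin n → ℝ)) (hA : ∀ q, ∀ z ∈ W, sys.A q *ᵥ z ∈ W)
    (hC : ∀ q, ∀ z ∈ W, sys.C q *ᵥ z = 0) : W = ⊥ := by
  have hm := isMorphism_to_ofLinearMaps (sys := sys)
    (Module.finBasis ℝ ((Fin n → ℝ) ⧸ W)).equivFun
    (a := fun q => W.mapQ W (sys.A q).mulVecLin (hA q))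
    (b := fun q => W.mkQ ∘ₗ (sys.B q).mulVecLin)
    (c := fun q => W.liftQ (sys.C q).mulVecLin (hC q)) (f := W.mkQ)
    (fun _ _ => rfl) (fun _ _ => rfl) (fun _ _ => rfl)
  have h1 := h _ _ (hm.equivalent τ).symm
  have h2 := W.finrank_quotient_add_finrank
  rw [Module.finrank_fin_fun] at h2
  exact Submodule.finrank_eq_zero.1 (by omega)

theorem Equivalent.exists_linking_submodule {τ : TimeKind} (hD : 1 ≤ D) {sys₁ : LSS D n₁ m p}
    {sys₂ : LSS D n₂ m p} (h : sys₁.Equivalent τ sys₂) :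
    ∃ L : Submodule ℝ ((Fin n₁ → ℝ) × (Fin n₂ → ℝ)),
      (∀ q, ∀ z ∈ L, (sys₁.A q *ᵥ z.1, sys₂.A q *ᵥ z.2) ∈ L) ∧
      (∀ q v, (sys₁.B q *ᵥ v, sys₂.B q *ᵥ v) ∈ L) ∧
      ∀ q, ∀ z ∈ L, sys₁.C q *ᵥ z.1 = sys₂.C q *ᵥ z.2 := by
  refine ⟨Submodule.span ℝ (jointReach τ sys₁ sys₂), fun q z hz => ?_, fun q v => ?_,
    fun q z hz => ?_⟩
  · induction hz using Submodule.span_induction with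
    | mem z hz => simpa using step_mem_span_jointReach hz q 0
    | zero =>
      simp only [Prod.fst_zero, Prod.snd_zero, mulVec_zero]
      exact zero_mem _
    | add z w _ _ hz hw => simpa [mulVec_add] using add_mem hz hw
    | smul r z _ hz => simpa [mulVec_smul] using Submodule.smul_mem _ r hz
  · simpa using step_mem_span_jointReach (zero_mem_jointReach (τ := τ) (sys₁ := sys₁)
      (sys₂ := sys₂) ⟨0, hD⟩) q v
  · induction hz using Submodule.span_induction with
    | mem z hz => exact h.output_eq_of_mem_jointReach hz q
    | zero => simp
    | add z w _ _ hz hw => simp [mulVec_add, hz, hw]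
    | smul r z _ hz => simp [mulVec_smul, hz]

/-- A minimal system is a quotient of a subsystem of any equivalent system. -/
theorem IsMinimal.exists_subquotient {τ : TimeKind} (hD : 1 ≤ D) {sys : LSS D n₁ m p}
    {sysm : LSS D n₂ m p} (hm : sysm.IsMinimal τ) (h : sysm.Equivalent τ sys) :
    ∃ (l : ℕ) (sys' : LSS D l m p) (V : Matrix (Fin n₁) (Fin l) ℝ) (L : Matrix (Fin l) (Fin n₁) ℝ)
      (W : Matrix (Fin n₂) (Fin l) ℝ) (R : Matrix (Fin l) (Fin n₂) ℝ),
      IsMorphism V sys' sys ∧ L * V = 1 ∧ IsMorphism W sys' sysm ∧ W * R = 1 := by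
  obtain ⟨N, hA, hB, hC⟩ := h.symm.exists_linking_submodule hD
  set π₁ : N →ₗ[ℝ] (Fin n₁ → ℝ) := LinearMap.fst ℝ _ _ ∘ₗ N.subtype with hπ₁
  set π₂ : N →ₗ[ℝ] (Fin n₂ → ℝ) := LinearMap.snd ℝ _ _ ∘ₗ N.subtype with hπ₂
  have hsurj : LinearMap.range π₂ = ⊤ := by
    refine hm.reachable _ ?_ ?_
    · rintro q _ ⟨z, rfl⟩
      exact ⟨⟨_, hA q z z.2⟩, rfl⟩
    · exact fun q v => ⟨⟨_, hB q v⟩, rfl⟩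
  -- Second components paired with zero in `N` form an invariant subspace on which every output of
  -- `sysm` vanishes.
  have hker : N.comap (LinearMap.inr ℝ (Fin n₁ → ℝ) (Fin n₂ → ℝ)) = ⊥ := by
    refine hm.observable _ ?_ ?_
    · intro q z hz
      simpa using hA q _ hz
    · intro q z hz
      simpa using (hC q _ hz).symm
  have hinj : LinearMap.ker π₁ = ⊥ := by
    rw [LinearMap.ker_eq_bot']
    rintro ⟨⟨z₁, z₂⟩, hz⟩ (rfl : z₁ = 0)
    have : z₂ ∈ N.comap (LinearMap.inr ℝ (Fin n₁ → ℝ) (Fin n₂ → ℝ)) := hz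
    rw [hker, Submodule.mem_bot] at this
    subst this
    rfl
  obtain ⟨g, hg⟩ := LinearMap.exists_leftInverse_of_injective π₁ hinj
  obtain ⟨r, hr⟩ := LinearMap.exists_rightInverse_of_surjective π₂ hsurj
  let e := (Module.finBasis ℝ N).equivFun
  let a : Fin D → N →ₗ[ℝ] N := fun q =>
    ((sys.A q).mulVecLin.prodMap (sysm.A q).mulVecLin).restrict (hA q)
  let b : Fin D → (Fin m → ℝ) →ₗ[ℝ] N := fun q =>
    ((sys.B q).mulVecLin.prod (sysm.B q).mulVecLin).codRestrict N (hB q)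
  refine ⟨_, ofLinearMaps e a b fun q => (sys.C q).mulVecLin ∘ₗ π₁,
    LinearMap.toMatrix' (π₁ ∘ₗ e.symm.toLinearMap), LinearMap.toMatrix' (e.toLinearMap ∘ₗ g),
    LinearMap.toMatrix' (π₂ ∘ₗ e.symm.toLinearMap), LinearMap.toMatrix' (e.toLinearMap ∘ₗ r),
    ?_, ?_, ?_, ?_⟩
  · exact isMorphism_from_ofLinearMaps e (fun _ _ => rfl) (fun _ _ => rfl) (fun _ _ => rfl)
  · rw [← LinearMap.toMatrix'_comp, ← LinearMap.toMatrix'_id]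
    congr 1
    ext1 v
    ext1
    simpa using congrArg e (LinearMap.congr_fun hg (e.symm (Pi.single v 1)))
  · exact isMorphism_from_ofLinearMaps e (fun _ _ => rfl) (fun _ _ => rfl)
      (fun q z => (hC q z z.2).symm)
  · rw [← LinearMap.toMatrix'_comp, ← LinearMap.toMatrix'_id]
    congr 1
    ext1 v
    ext1
    simpa using LinearMap.congr_fun hr (Pi.single v 1)

/-- Minimality of `sys₁` forces its subsystem `sys'` to have full dimension. Then `V` and `W` are
square and invertible, with `V⁻¹ = L`, and `W * L` is the isomorphism. -/
theorem IsMinimal.exists_isIsomorphism {τ : TimeKind} (hD : 1 ≤ D) {sys₁ sys₂ : LSS D n m p}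
    (h₁ : sys₁.IsMinimal τ) (h₂ : sys₂.IsMinimal τ) (h : sys₁.Equivalent τ sys₂) :
    ∃ S, IsIsomorphism S sys₁ sys₂ := by
  obtain ⟨l, sys', V, L, W, R, hV, hLV, hW, hWR⟩ := h₂.exists_subquotient hD h.symm
  have hln : n ≤ l := h₁ l sys' (hV.equivalent τ)
  have hnl : l ≤ n := by
    have h1 : (L * V).rank ≤ n :=
      (rank_mul_le_right _ _).trans ((rank_le_card_height V).trans (by simp))
    simpa [hLV] using h1
  obtain rfl := le_antisymm hln hnl
  have hVL : V * L = 1 := mul_eq_one_comm.1 hLV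
  have hRW : R * W = 1 := mul_eq_one_comm.1 hWR
  refine ⟨W * L, ?_, fun q => ⟨?_, ?_, ?_⟩⟩
  · refine IsUnit.of_mul_eq_one (V * R) ?_
    rw [Matrix.mul_assoc, ← Matrix.mul_assoc L, hLV, Matrix.one_mul, hWR]
  · have : sys'.A q * L = L * sys₁.A q := by
      calc sys'.A q * L = L * (V * sys'.A q) * L := by
            rw [← Matrix.mul_assoc, hLV, Matrix.one_mul]
        _ = L * sys₁.A q := by
            rw [← (hV q).1, Matrix.mul_assoc, Matrix.mul_assoc, hVL, Matrix.mul_one]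
    rw [← Matrix.mul_assoc, (hW q).1, Matrix.mul_assoc, this, Matrix.mul_assoc]
  · rw [(hV q).2.1, Matrix.mul_assoc, ← Matrix.mul_assoc L, hLV, Matrix.one_mul, (hW q).2.1]
  · rw [← Matrix.mul_assoc, (hW q).2.2, ← (hV q).2.2, Matrix.mul_assoc, hVL, Matrix.mul_one]

end LSS

/-! ### Assembly of the theorem -/

theorem mainTheorem2 (τ : TimeKind) (D m p : ℕ) (hD : 1 ≤ D) (K : LMISymbol) :
    -- Part 1
    (∀ (n k : ℕ) (sys : LSS D n m p) (sysm : LSS D k m p),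
      sysm.IsMinimal τ → sysm.Equivalent τ sys →
      (sys.solutionSet τ K).Nonempty → (sysm.solutionSet τ K).Nonempty) ∧
    -- Part 2
    (∀ (n k : ℕ) (sys : LSS D n m p) (sysm : LSS D k m p),
      sysm.IsMinimal τ → sysm.Equivalent τ sys →
      ∀ P ∈ sys.solutionSet τ .C, ∀ R ∈ sys.solutionSet τ .O,
      ∃ Pm ∈ sysm.solutionSet τ .C, ∃ Rm ∈ sysm.solutionSet τ .O,
      ∃ (σ : Fin n → ℝ) (μ : Fin k → ℝ),
        IsSingularValues P R σ ∧ IsSingularValues Pm Rm μ ∧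
        ∃ hkn : k ≤ n, ∀ i : Fin k,
          σ ⟨n - k + i, by omega⟩ ≤ μ i ∧ μ i ≤ σ ⟨i, by omega⟩) ∧
    -- Part 3, for a given isomorphism
    (∀ (n : ℕ) (sys₁ sys₂ : LSS D n m p) (S : Matrix (Fin n) (Fin n) ℝ),
      LSS.IsIsomorphism S sys₁ sys₂ →
      ∀ P : Matrix (Fin n) (Fin n) ℝ,
        P ∈ sys₁.solutionSet τ K ↔
          (K.congruenceMatrix S)ᵀ * P * K.congruenceMatrix S ∈ sys₂.solutionSet τ K) ∧
    -- Part 3, for equivalent minimal systems (whose dimensions turn out to be equal)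
    (∀ (n₁ n₂ : ℕ) (sys₁ : LSS D n₁ m p) (sys₂ : LSS D n₂ m p),
      sys₁.IsMinimal τ → sys₂.IsMinimal τ → sys₁.Equivalent τ sys₂ →
      n₁ = n₂ ∧
      ∃ (M : Matrix (Fin n₁) (Fin n₂) ℝ) (N : Matrix (Fin n₂) (Fin n₁) ℝ),
        M * N = 1 ∧ N * M = 1 ∧
        ∀ P : Matrix (Fin n₁) (Fin n₁) ℝ,
          P ∈ sys₁.solutionSet τ K ↔ Mᵀ * P * M ∈ sys₂.solutionSet τ K) := by
  refine ⟨?_, ?_, fun n sys₁ sys₂ S hS P => hS.mem_solutionSet_iff P, ?_⟩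
  · rintro n k sys sysm hmin heq ⟨P, hP⟩
    obtain ⟨l, sys', V, L, W, R, hV, hLV, hW, hWR⟩ := hmin.exists_subquotient hD heq
    by_cases hK : K = .C
    · subst hK
      exact ⟨_, hW.quotient_mem_C (hV.restrict_mem_C hP hLV) hWR⟩
    · exact ⟨_, hW.quotient_mem hK (hV.restrict_mem hK hP hLV) hWR⟩
  · intro n k sys sysm hmin heq P hP R hR
    obtain ⟨l, sys', V, L, W, Z, hV, hLV, hW, hWZ⟩ := hmin.exists_subquotient hD heq
    have hP' := hV.restrict_mem_C hP hLV
    have hR' := hV.restrict_mem (by simp) hR hLV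
    have hPm := hW.quotient_mem_C hP' hWZ
    have hRm := hW.quotient_mem (by simp) hR' hWZ
    obtain ⟨T, σ, hT, hσ, hTP, hTR⟩ := exists_simultaneous_diagonalization hP.1 hR.1.isHermitian
    have hs : IsSingularValues P R σ := .of_diagonalization hT hσ hTP hTR
    obtain ⟨ν, hν, hνσ⟩ := exists_interlacing_restrict hP.1 hR.1.isHermitian
      (posDef_inv_iff.1 hP'.1) hs
    -- Passing to the quotient by `W` is restriction along `Wᵀ` with the two Gramians exchanged. The
    -- exchange is harmless because `P * R` and `R * P` have the same characteristic polynomial.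
    obtain ⟨μ, hμ, hμν⟩ := exists_interlacing_restrict (V := Wᵀ) hR'.1 hP'.1.isHermitian
      (by rw [transpose_transpose]; exact posDef_inv_iff.1 hRm.1) hν.symm
    rw [transpose_transpose] at hμ
    exact ⟨_, hPm, _, hRm, σ, μ, hs, hμ.symm, hμν.trans hνσ⟩
  · intro n₁ n₂ sys₁ sys₂ h₁ h₂ h
    obtain rfl : n₁ = n₂ := le_antisymm (h₁ _ sys₂ h.symm) (h₂ _ sys₁ h)
    obtain ⟨S, hS⟩ := h₁.exists_isIsomorphism hD h₂ h
    refine ⟨rfl, K.congruenceMatrix S, K.congruenceMatrix S⁻¹, LSS.congruenceMatrix_mul_inv K hS.1,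
      mul_eq_one_comm.1 (LSS.congruenceMatrix_mul_inv K hS.1), fun P => hS.mem_solutionSet_iff P⟩
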